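/- Let $G$ be a finite group and $p$ a prime. Write $H^g=g^{-1}Hg$ and $N_G(H,K)=\{g\in G\mid H^g\le K\}$. Let $\mathcal S_G^*$ be the poset of nonidentity $p$-subgroups of $G$ ordered by inclusion, viewed as a category, and let $\mathcal T_G^*,\mathcal L_G^*,\mathcal F_G^*,\mathcal O_G^*,\widetilde{\mathcal F}_G^*$ be the categories with the same objects and with morphism sets $$\mathcal T_G^*(H,K)=N_G(H,K),\quad \mathcal L_G^*(H,K)=O^pC_G(H)\backslash N_G(H,K),\quad \mathcal F_G^*(H,K)=C_G(H)\backslash N_G(H,K),$$ $$\mathcal O_G^*(H,K)=N_G(H,K)/K,\quad \widetilde{\mathcal F}_G^*(H,K)=C_G(H)\backslash N_G(H,K)/K,$$ composition being induced by multiplication in $G$; here $O^pX$ is the smallest normal subgroup of $X$ whose quotient is a $p$-group. Write $\mathcal C(H)=\mathcal C(H,H)$. A weighting on a finite category $\mathcal C$ is a function $k^\bullet\colon\mathrm{Ob}(\mathcal C)\to\mathbf Q$ with $\sum_b|\mathcal C(a,b)|k^b=1$ for all $a$; a coweighting is a function $k_\bullet\colon\mathrm{Ob}(\mathcal C)\to\mathbf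 Q$ with $\sum_a k_a|\mathcal C(a,b)|=1$ for all $b$. If $\mathcal C$ has both, it is said to have Euler characteristic, and $\chi(\mathcal C)$ is the sum of the values of any weighting or coweighting. Let $\mu(H,K)$ be the Möbius function of the poset of all subgroups of $G$, and $\mu(K)=\mu(1,K)$. All six categories have Euler characteristic, and: 1. For $\mathcal C^*=\mathcal T_G^*,\mathcal L_G^*,\mathcal F_G^*$, $$\chi(\mathcal C^*)=\sum_{[H]}\frac{-\mu(H)}{|\mathcal C^*(H)|},$$ the sum running over the conjugacy classes of nonidentity $p$-subgroups of $G$. 2. $\chi(\mathcal S_G^*)=|G|\,\chi(\mathcal T_G^*)$ and $\chi(\widetilde{\mathcal F}_G^*)=\chi(\mathcal F_G^*)$. 3. $$\chi(\mathcal O_G^*)=\chi(\mathcal T_G^*)+\frac{p-1}{p}\sum_{[C]}\frac1{|\mathcal O_G^*(C)|}=\chi(\mathcal T_G^*)+\frac1{|G|}\frac{p-1}{p}\sum_{C}|C|=\frac1{|G|}\sum_{H,K}|H|\,\mu(H,K),$$ where $[C]$ runs over the conjugacy classes of nonidentity cyclic $p$-subgroups, $C$ over all nonidentity cyclic $p$-subgroups,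 and $H,K$ over all nonidentity $p$-subgroups of $G$. 4. The following are a weighting $k^\bullet$ and a coweighting $k_\bullet$ for the indicated category (sums over nonidentity $p$-subgroups $K$, respectively $H$, of $G$): - $\mathcal S_G^*$: $k^H=\sum_K\mu(H,K)$ and $k_K=-\mu(K)$; - $\mathcal T_G^*$: $k^H=|G|^{-1}\sum_K\mu(H,K)$ and $k_K=-|G|^{-1}\mu(K)$; - $\mathcal L_G^*$: $k^H=|G|^{-1}\sum_K\mu(H,K)\,|O^pC_G(K)|$ and $k_K=-|G|^{-1}\mu(K)\,|O^pC_G(K)|$; - $\mathcal F_G^*$: $k^H=|G|^{-1}\sum_K\mu(H,K)\,|C_G(K)|$ and $k_K=-|G|^{-1}\mu(K)\,|C_G(K)|$; - $\mathcal O_G^*$: $k^H=|G|^{-1}|H|\sum_K\mu(H,K)$ and $k_K=|G|^{-1}\sum_H|H|\,\mu(H,K)$. -/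

import Mathlib

open scoped CategoryTheory

/-! ### Weightings and Euler characteristic of a finite category -/

section EulerCharacteristic

universe v u

/-- A weighting on a finite category `C`: a rational function `k` on the objects with
`∑ b, |C(a, b)| * k b = 1` for all objects `a`. -/
def IsWeighting (C : Type u) [CategoryTheory.Category.{v} C] [Fintype C]
    [∀ a b : C, Finite (a ⟶ b)] (k : C → ℚ) : Prop :=
  ∀ a : C, ∑ b : C, (Nat.card (a ⟶ b) : ℚ) * k b = 1

/-- A coweighting on a finite category `C`: a rational function `k` on the objects with
`∑ a, k a * |C(a, b)| = 1` for all objects `b`. -/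
def IsCoweighting (C : Type u) [CategoryTheory.Category.{v} C] [Fintype C]
    [∀ a b : C, Finite (a ⟶ b)] (k : C → ℚ) : Prop :=
  ∀ b : C, ∑ a : C, k a * (Nat.card (a ⟶ b) : ℚ) = 1

/-- A finite category has Euler characteristic if it admits both a weighting and a coweighting. -/
def HasEulerChar (C : Type u) [CategoryTheory.Category.{v} C] [Fintype C]
    [∀ a b : C, Finite (a ⟶ b)] : Prop :=
  (∃ k : C → ℚ, IsWeighting C k) ∧ ∃ k : C → ℚ, IsCoweighting C k

open scoped Classical in
/-- The Euler characteristic of a finite category: the sum of the values of any weighting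
(equivalently, of any coweighting) if the category has Euler characteristic; otherwise the
value is meaningless. -/
noncomputable def eulerChar (C : Type u) [CategoryTheory.Category.{v} C] [Fintype C]
    [∀ a b : C, Finite (a ⟶ b)] : ℚ :=
  if h : HasEulerChar C then ∑ a : C, h.1.choose a else 0

/-- The sum of any weighting equals the sum of any coweighting. -/
theorem sum_weighting_eq_sum_coweighting {C : Type u} [CategoryTheory.Category.{v} C]
    [Fintype C] [∀ a b : C, Finite (a ⟶ b)] {k l : C → ℚ}
    (hk : IsWeighting C k) (hl : IsCoweighting C l) : ∑ a, k a = ∑ a, l a := by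
  calc ∑ b, k b = ∑ b, (∑ a, l a * (Nat.card (a ⟶ b) : ℚ)) * k b :=
        Finset.sum_congr rfl fun b _ => by rw [hl b, one_mul]
    _ = ∑ a, l a * ∑ b, (Nat.card (a ⟶ b) : ℚ) * k b := by
        simp_rw [Finset.sum_mul, Finset.mul_sum, mul_assoc]
        exact Finset.sum_comm
    _ = ∑ a, l a := Finset.sum_congr rfl fun a _ => by rw [hk a, mul_one]

/-- The Euler characteristic is the sum of any coweighting. -/
theorem HasEulerChar.eulerChar_eq_sum_coweighting {C : Type u}
    [CategoryTheory.Category.{v} C] [Fintype C] [∀ a b : C, Finite (a ⟶ b)]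
    (h : HasEulerChar C) {l : C → ℚ} (hl : IsCoweighting C l) : eulerChar C = ∑ a, l a := by
  rw [eulerChar, dif_pos h]
  exact sum_weighting_eq_sum_coweighting h.1.choose_spec hl

/-- The Euler characteristic is the sum of any weighting. -/
theorem HasEulerChar.eulerChar_eq_sum_weighting {C : Type u}
    [CategoryTheory.Category.{v} C] [Fintype C] [∀ a b : C, Finite (a ⟶ b)]
    (h : HasEulerChar C) {k : C → ℚ} (hk : IsWeighting C k) : eulerChar C = ∑ a, k a := by
  rw [h.eulerChar_eq_sum_coweighting h.2.choose_spec]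
  exact (sum_weighting_eq_sum_coweighting hk h.2.choose_spec).symm

end EulerCharacteristic

/-! ### The Möbius function of a finite group -/

section Moebius

open scoped Classical in
/-- The Möbius function `μ(H, K)` of the poset of all subgroups of the finite group `G`. -/
noncomputable def subgroupMu {G : Type*} [Group G] [Finite G] (H K : Subgroup G) : ℚ :=
  letI : Fintype (Subgroup G) := Fintype.ofFinite _
  letI : LocallyFiniteOrder (Subgroup G) := Fintype.toLocallyFiniteOrder
  IncidenceAlgebra.mu ℚ H K

end Moebius

/-! ### Conjugation, transporters and `O^p` -/

section GroupTheory

variable {G : Type*} [Group G]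

/-- `H ^ g = g⁻¹ H g`. -/
def conjBy (H : Subgroup G) (g : G) : Subgroup G :=
  H.map (MulAut.conj g⁻¹).toMonoidHom

theorem conjBy_le_iff {H K : Subgroup G} {g : G} :
    conjBy H g ≤ K ↔ ∀ h ∈ H, g⁻¹ * h * g ∈ K := by
  simp [conjBy, SetLike.le_def]

/-- `O^p(X)`: the smallest normal subgroup of the finite group `X` whose quotient is a
`p`-group, that is, the intersection of all of these. -/
def pResidual (p : ℕ) (X : Type*) [Group X] : Subgroup X :=
  sInf {N : Subgroup X | ∃ _ : N.Normal, IsPGroup p (X ⧸ N)}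

/-- `O^p(C_G(H))`, as a subgroup of `G`. -/
def pResidualCentralizer (p : ℕ) (H : Subgroup G) : Subgroup G :=
  (pResidual p (Subgroup.centralizer (H : Set G))).map
    (Subgroup.centralizer (H : Set G)).subtype

theorem pResidual_map_le (p : ℕ) {X Y : Type*} [Group X] [Group Y] (f : X →* Y) :
    (pResidual p X).map f ≤ pResidual p Y := by
  rw [Subgroup.map_le_iff_le_comap]
  intro x hx
  rw [Subgroup.mem_comap]
  refine Subgroup.mem_sInf.2 ?_
  rintro N ⟨hN, hp⟩
  have key : N.comap f ∈ {N : Subgroup X | ∃ _ : N.Normal, IsPGroup p (X ⧸ N)} := by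
    refine ⟨inferInstance, ?_⟩
    refine hp.of_injective (QuotientGroup.map (N.comap f) N f le_rfl) ?_
    rw [injective_iff_map_eq_one]
    intro a
    induction a using QuotientGroup.induction_on with
    | H a =>
      intro h
      rw [QuotientGroup.map_mk, QuotientGroup.eq_one_iff] at h
      rw [QuotientGroup.eq_one_iff]
      exact h
  exact Subgroup.mem_sInf.1 hx _ key

theorem centralizer_conj_mem {H K : Subgroup G} {g : G} (hg : conjBy H g ≤ K) {c : G}
    (hc : c ∈ Subgroup.centralizer (K : Set G)) :
    g * c * g⁻¹ ∈ Subgroup.centralizer (H : Set G) := by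
  rw [Subgroup.mem_centralizer_iff] at hc ⊢
  intro h hh
  have := hc _ (conjBy_le_iff.1 hg h hh)
  calc h * (g * c * g⁻¹) = g * (g⁻¹ * h * g * c) * g⁻¹ := by group
    _ = g * (c * (g⁻¹ * h * g)) * g⁻¹ := by rw [this]
    _ = g * c * g⁻¹ * h := by group

theorem pResidualCentralizer_conj_mem (p : ℕ) {H K : Subgroup G} {g : G}
    (hg : conjBy H g ≤ K) {c : G} (hc : c ∈ pResidualCentralizer p K) :
    g * c * g⁻¹ ∈ pResidualCentralizer p H := by
  obtain ⟨x, hx, rfl⟩ := hc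
  let f : Subgroup.centralizer (K : Set G) →* Subgroup.centralizer (H : Set G) :=
    ((MulAut.conj g).toMonoidHom.comp (Subgroup.centralizer (K : Set G)).subtype).codRestrict _
      fun y => centralizer_conj_mem hg y.2
  exact ⟨f x, pResidual_map_le p f ⟨x, hx, rfl⟩, rfl⟩

end GroupTheory

/-! ### The categories of nonidentity `p`-subgroups -/

/-- A nonidentity `p`-subgroup of `G`. With the inclusion order this is the poset `S_G^*`, which
is regarded as a category in the usual way. -/
@[ext]
structure NonidPSubgroup (p : ℕ) (G : Type*) [Group G] where
  /-- the underlying subgroup -/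
  toSubgroup : Subgroup G
  isPGroup : IsPGroup p toSubgroup
  ne_bot : toSubgroup ≠ ⊥

theorem NonidPSubgroup.toSubgroup_injective (p : ℕ) (G : Type*) [Group G] :
    Function.Injective (NonidPSubgroup.toSubgroup : NonidPSubgroup p G → Subgroup G) :=
  fun _ _ h => NonidPSubgroup.ext h

instance (p : ℕ) (G : Type*) [Group G] : PartialOrder (NonidPSubgroup p G) :=
  PartialOrder.lift NonidPSubgroup.toSubgroup (NonidPSubgroup.toSubgroup_injective p G)

instance (p : ℕ) (G : Type*) [Group G] [Finite G] : Finite (NonidPSubgroup p G) :=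
  Finite.of_injective _ (NonidPSubgroup.toSubgroup_injective p G)

noncomputable instance (p : ℕ) (G : Type*) [Group G] [Finite G] :
    Fintype (NonidPSubgroup p G) :=
  Fintype.ofFinite _

/-- Conjugacy in `G` of nonidentity `p`-subgroups: `H ^ g = K` for some `g`. -/
def conjSetoid (p : ℕ) (G : Type*) [Group G] : Setoid (NonidPSubgroup p G) where
  r H K := ∃ g : G, conjBy H.toSubgroup g = K.toSubgroup
  iseqv :=
    { refl := fun H => ⟨1, by ext x; simp [conjBy]⟩
      symm := by
        rintro H K ⟨g, hg⟩
        refine ⟨g⁻¹, ?_⟩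
        rw [← hg]
        ext x
        simp [conjBy, mul_assoc]
      trans := by
        rintro H K L ⟨g, hg⟩ ⟨k, hk⟩
        refine ⟨g * k, ?_⟩
        rw [← hk, ← hg]
        ext x
        simp [conjBy, mul_assoc] }

/-- The set of conjugacy classes of nonidentity `p`-subgroups of `G`. -/
def ConjClassesNonidP (p : ℕ) (G : Type*) [Group G] : Type _ :=
  Quotient (conjSetoid p G)

noncomputable instance (p : ℕ) (G : Type*) [Group G] [Finite G] :
    Fintype (ConjClassesNonidP p G) :=
  haveI : Finite (ConjClassesNonidP p G) := inferInstanceAs (Finite (Quotient (conjSetoid p G)))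
  Fintype.ofFinite _

/-- The conjugacy class `[H]`. -/
def NonidPSubgroup.conjClass {p : ℕ} {G : Type*} [Group G] (H : NonidPSubgroup p G) :
    ConjClassesNonidP p G :=
  Quotient.mk (conjSetoid p G) H

/-- The objects of the transporter category `T_G^*`: nonidentity `p`-subgroups of `G`. -/
@[ext]
structure TransporterCat (p : ℕ) (G : Type*) [Group G] where
  /-- the underlying nonidentity `p`-subgroup -/
  sub : NonidPSubgroup p G

noncomputable instance (p : ℕ) (G : Type*) [Group G] [Finite G] :
    Fintype (TransporterCat p G) :=
  Fintype.ofEquiv (NonidPSubgroup p G)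
    ⟨TransporterCat.mk, TransporterCat.sub, fun _ => rfl, fun _ => rfl⟩

/-- The transporter category: `T_G^*(H, K) = N_G(H, K) = {g | H ^ g ≤ K}`, and the composite of
`g : H ⟶ K` and `h : K ⟶ L` is `g * h : H ⟶ L`. -/
instance (p : ℕ) (G : Type*) [Group G] : CategoryTheory.Category (TransporterCat p G) where
  Hom H K := {g : G // conjBy H.sub.toSubgroup g ≤ K.sub.toSubgroup}
  id H := ⟨1, conjBy_le_iff.2 fun h hh => by simpa using hh⟩
  comp f g := ⟨f.1 * g.1, conjBy_le_iff.2 fun h hh => by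
    have := conjBy_le_iff.1 g.2 _ (conjBy_le_iff.1 f.2 h hh)
    simpa [mul_assoc] using this⟩
  id_comp f := Subtype.ext (one_mul _)
  comp_id f := Subtype.ext (mul_one _)
  assoc f g h := Subtype.ext (mul_assoc _ _ _)

instance (p : ℕ) (G : Type*) [Group G] [Finite G] (H K : TransporterCat p G) :
    Finite (H ⟶ K) :=
  inferInstanceAs (Finite {g : G // conjBy H.sub.toSubgroup g ≤ K.sub.toSubgroup})

section Quotients

variable (p : ℕ) (G : Type*) [Group G]

/-- The relation on `N_G(H, K)` whose quotient is `O^p C_G(H) \ N_G(H, K)`. -/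
def linkingRel : HomRel (TransporterCat p G) := fun H _ f f' =>
  ∃ c ∈ pResidualCentralizer p H.sub.toSubgroup, f'.1 = c * f.1

/-- The relation on `N_G(H, K)` whose quotient is `C_G(H) \ N_G(H, K)`. -/
def frobeniusRel : HomRel (TransporterCat p G) := fun H _ f f' =>
  ∃ c ∈ Subgroup.centralizer (H.sub.toSubgroup : Set G), f'.1 = c * f.1

/-- The relation on `N_G(H, K)` whose quotient is `N_G(H, K) / K`. -/
def orbitRel : HomRel (TransporterCat p G) := fun _ K f f' =>
  ∃ k ∈ K.sub.toSubgroup, f'.1 = f.1 * k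

/-- The relation on `N_G(H, K)` whose quotient is `C_G(H) \ N_G(H, K) / K`. -/
def exteriorRel : HomRel (TransporterCat p G) := fun H K f f' =>
  ∃ c ∈ Subgroup.centralizer (H.sub.toSubgroup : Set G), ∃ k ∈ K.sub.toSubgroup,
    f'.1 = c * f.1 * k

/- The four relations are congruences, so that the morphism sets of the quotient categories below
are exactly the sets of equivalence classes, with composition induced from multiplication. -/

theorem transporter_coe_comp {H K L : TransporterCat p G} (f : H ⟶ K) (g : K ⟶ L) :
    (f ≫ g).1 = f.1 * g.1 := rfl

instance : CategoryTheory.Congruence (linkingRel p G) where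
  equivalence :=
    { refl := fun f => ⟨1, one_mem _, (one_mul _).symm⟩
      symm := by
        rintro f f' ⟨c, hc, h⟩
        exact ⟨c⁻¹, inv_mem hc, by rw [h]; group⟩
      trans := by
        rintro f f' f'' ⟨c, hc, h⟩ ⟨d, hd, h'⟩
        exact ⟨d * c, mul_mem hd hc, by rw [h', h]; group⟩ }
  comp_left := by
    rintro H K L f g g' ⟨c, hc, h⟩
    exact ⟨_, pResidualCentralizer_conj_mem p f.2 hc, by rw [transporter_coe_comp, transporter_coe_comp, h]; group⟩
  comp_right := by
    rintro H K L f f' g ⟨c, hc, h⟩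
    exact ⟨c, hc, by rw [transporter_coe_comp, transporter_coe_comp, h]; group⟩

instance : CategoryTheory.Congruence (frobeniusRel p G) where
  equivalence :=
    { refl := fun f => ⟨1, one_mem _, (one_mul _).symm⟩
      symm := by
        rintro f f' ⟨c, hc, h⟩
        exact ⟨c⁻¹, inv_mem hc, by rw [h]; group⟩
      trans := by
        rintro f f' f'' ⟨c, hc, h⟩ ⟨d, hd, h'⟩
        exact ⟨d * c, mul_mem hd hc, by rw [h', h]; group⟩ }
  comp_left := by
    rintro H K L f g g' ⟨c, hc, h⟩
    exact ⟨_, centralizer_conj_mem f.2 hc, by rw [transporter_coe_comp, transporter_coe_comp, h]; group⟩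
  comp_right := by
    rintro H K L f f' g ⟨c, hc, h⟩
    exact ⟨c, hc, by rw [transporter_coe_comp, transporter_coe_comp, h]; group⟩

instance : CategoryTheory.Congruence (orbitRel p G) where
  equivalence :=
    { refl := fun f => ⟨1, one_mem _, (mul_one _).symm⟩
      symm := by
        rintro f f' ⟨c, hc, h⟩
        exact ⟨c⁻¹, inv_mem hc, by rw [h]; group⟩
      trans := by
        rintro f f' f'' ⟨c, hc, h⟩ ⟨d, hd, h'⟩
        exact ⟨c * d, mul_mem hc hd, by rw [h', h]; group⟩ }
  comp_left := by
    rintro H K L f g g' ⟨k, hk, h⟩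
    exact ⟨k, hk, by rw [transporter_coe_comp, transporter_coe_comp, h]; group⟩
  comp_right := by
    rintro H K L f f' g ⟨k, hk, h⟩
    exact ⟨_, conjBy_le_iff.1 g.2 k hk, by rw [transporter_coe_comp, transporter_coe_comp, h]; group⟩

instance : CategoryTheory.Congruence (exteriorRel p G) where
  equivalence :=
    { refl := fun f => ⟨1, one_mem _, 1, one_mem _, by group⟩
      symm := by
        rintro f f' ⟨c, hc, k, hk, h⟩
        exact ⟨c⁻¹, inv_mem hc, k⁻¹, inv_mem hk, by rw [h]; group⟩
      trans := by
        rintro f f' f'' ⟨c, hc, k, hk, h⟩ ⟨d, hd, l, hl, h'⟩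
        exact ⟨d * c, mul_mem hd hc, k * l, mul_mem hk hl, by rw [h', h]; group⟩ }
  comp_left := by
    rintro H K L f g g' ⟨c, hc, k, hk, h⟩
    exact ⟨_, centralizer_conj_mem f.2 hc, k, hk, by rw [transporter_coe_comp, transporter_coe_comp, h]; group⟩
  comp_right := by
    rintro H K L f f' g ⟨c, hc, k, hk, h⟩
    exact ⟨c, hc, _, conjBy_le_iff.1 g.2 k hk, by rw [transporter_coe_comp, transporter_coe_comp, h]; group⟩

/-- The linking category `L_G^*`, with `L_G^*(H, K) = O^p C_G(H) \ N_G(H, K)`. -/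
abbrev LinkingCat := CategoryTheory.Quotient (linkingRel p G)

/-- The Frobenius (fusion) category `F_G^*`, with `F_G^*(H, K) = C_G(H) \ N_G(H, K)`. -/
abbrev FrobeniusCat := CategoryTheory.Quotient (frobeniusRel p G)

/-- The orbit category `O_G^*`, with `O_G^*(H, K) = N_G(H, K) / K`. -/
abbrev OrbitCat := CategoryTheory.Quotient (orbitRel p G)

/-- The exterior quotient of the Frobenius category, with morphism sets
`C_G(H) \ N_G(H, K) / K`. -/
abbrev ExteriorCat := CategoryTheory.Quotient (exteriorRel p G)

variable {p G}

/-- The nonidentity `p`-subgroup `H` as an object of a quotient category of `T_G^*`. -/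
abbrev NonidPSubgroup.toQuot (r : HomRel (TransporterCat p G)) (H : NonidPSubgroup p G) :
    CategoryTheory.Quotient r :=
  ⟨⟨H⟩⟩

/-- The number `|C(a)|` of endomorphisms of an object. -/
noncomputable def cardEnd {C : Type*} [CategoryTheory.Category C] (a : C) : ℚ :=
  (Nat.card (a ⟶ a) : ℚ)

end Quotients

noncomputable instance {C : Type*} [CategoryTheory.Category C] [Fintype C] (r : HomRel C) :
    Fintype (CategoryTheory.Quotient r) :=
  Fintype.ofEquiv C ⟨CategoryTheory.Quotient.mk, CategoryTheory.Quotient.as,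
    fun _ => rfl, fun _ => rfl⟩

instance {C : Type*} [CategoryTheory.Category C] [∀ a b : C, Finite (a ⟶ b)] (r : HomRel C)
    (a b : CategoryTheory.Quotient r) : Finite (a ⟶ b) :=
  inferInstanceAs (Finite (Quot (@CategoryTheory.HomRel.CompClosure C _ r a.as b.as)))

/-! ### Möbius inversion over the nonidentity `p`-subgroups -/

section MoebiusSums

variable {p : ℕ} {G : Type*} [Group G]

/-! Everything reduces to Möbius inversion in the poset `NonidPSubgroup p G`. An interval `[H, L]`
or `(1, L]` below a `p`-subgroup `L`, with `H ≠ 1`, contains only nonidentity `p`-subgroups, so the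
Möbius function of the full subgroup lattice inverts the zeta matrix of the poset.

The number `|N_G(H, K)|` is the sum over `g` of the truth values of `H ^ g ≤ K`. Applied to a Möbius
transform of a conjugation invariant function `a`, every `g` contributes the same value, so the
transporter matrix returns `|G| a` (`sum_transporterCard_mul`, `sum_mul_transporterCard`). The
groups `O^p C_G(H)` and `C_G(H)` act freely from the left on `N_G(H, K)`, and `K` acts freely from
the right. The linking, Frobenius and orbit matrices are therefore the transporter matrix divided by
an invariant function of the source or of the target, which yields their weightings and
coweightings.

The two-sided action behind the exterior quotient is not free. Burnside's lemma
(`card_hom_exterior_mul`) expresses its morphism counts as averages over `b ∈ K` of Frobenius counts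
into `C_K(b)`, so a Frobenius coweighting remains a coweighting. A weighting exists because the
category is triangular with respect to subgroup order (`exists_isWeighting_of_rank`).

Euler characteristics come from summing these functions, grouped by conjugacy classes via
orbit-stabilizer. The cyclic subgroups enter the orbit category formula because `|L| - 1` counts the
generators of the nonidentity cyclic subgroups of `L`; inverting this relation gives
`sum_card_mul_subgroupMu`. -/

theorem subgroupMu_eq_zero [Finite G] {H K : Subgroup G} (h : ¬H ≤ K) : subgroupMu H K = 0 := by
  classical
  exact IncidenceAlgebra.apply_eq_zero_of_not_le h _

namespace NonidPSubgroup

theorem le_def {H K : NonidPSubgroup p G} : H ≤ K ↔ H.toSubgroup ≤ K.toSubgroup := Iff.rfl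

/-- A subgroup between nonidentity `p`-subgroups. -/
def ofLe {H : Subgroup G} (L : NonidPSubgroup p G) (hH : H ≠ ⊥) (h : H ≤ L.toSubgroup) :
    NonidPSubgroup p G :=
  ⟨H, L.isPGroup.to_le h, hH⟩

/-- Transfers the interval identities for the Möbius function of the full subgroup lattice to sums
over nonidentity `p`-subgroups. -/
theorem sum_eq_sum_of_support [Finite G] (f : Subgroup G → ℚ) (s : Finset (Subgroup G))
    (hf : ∀ L ∈ s, ∃ K : NonidPSubgroup p G, K.toSubgroup = L)
    (hs : ∀ K : NonidPSubgroup p G, K.toSubgroup ∉ s → f K.toSubgroup = 0) :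
    ∑ K : NonidPSubgroup p G, f K.toSubgroup = ∑ L ∈ s, f L := by
  classical
  rw [← Finset.sum_filter_of_ne (p := fun K : NonidPSubgroup p G => K.toSubgroup ∈ s)
    fun K _ h => by_contra fun h' => h (hs K h')]
  refine Finset.sum_bij (fun K _ => K.toSubgroup) (by simp)
    (fun _ _ _ _ h => NonidPSubgroup.ext h) (fun L hL => ?_) (fun _ _ => rfl)
  obtain ⟨K, rfl⟩ := hf L hL
  exact ⟨K, by simpa using hL, rfl⟩

open scoped Classical in
theorem sum_le_subgroupMu_left [Finite G] (H L : NonidPSubgroup p G) :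
    ∑ K : NonidPSubgroup p G, (if H ≤ K then subgroupMu K.toSubgroup L.toSubgroup else 0) =
      if H = L then 1 else 0 := by
  let _ : Fintype (Subgroup G) := Fintype.ofFinite _
  let _ : LocallyFiniteOrder (Subgroup G) := Fintype.toLocallyFiniteOrder
  have h1 := IncidenceAlgebra.sum_Icc_mu_left (𝕜 := ℚ) H.toSubgroup L.toSubgroup
  have h2 := sum_eq_sum_of_support (p := p)
    (fun K => if H.toSubgroup ≤ K then subgroupMu K L.toSubgroup else 0)
    (Finset.Icc H.toSubgroup L.toSubgroup)
    (fun K hK => ⟨L.ofLe (ne_bot_of_le_ne_bot H.ne_bot (Finset.mem_Icc.1 hK).1)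
      (Finset.mem_Icc.1 hK).2, rfl⟩)
    (fun K hK => by
      rw [Finset.mem_Icc, not_and] at hK
      split_ifs with h
      exacts [subgroupMu_eq_zero (hK h), rfl])
  refine h2.trans (Eq.trans (Finset.sum_congr rfl fun K hK => ?_) (h1.trans ?_))
  · rw [if_pos (Finset.mem_Icc.1 hK).1]; rfl
  · simp only [NonidPSubgroup.ext_iff]

open scoped Classical in
theorem sum_le_subgroupMu_right [Finite G] (H L : NonidPSubgroup p G) :
    ∑ K : NonidPSubgroup p G, (if K ≤ L then subgroupMu H.toSubgroup K.toSubgroup else 0) =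
      if H = L then 1 else 0 := by
  let _ : Fintype (Subgroup G) := Fintype.ofFinite _
  let _ : LocallyFiniteOrder (Subgroup G) := Fintype.toLocallyFiniteOrder
  have h1 := IncidenceAlgebra.sum_Icc_mu_right (𝕜 := ℚ) H.toSubgroup L.toSubgroup
  have h2 := sum_eq_sum_of_support (p := p)
    (fun K => if K ≤ L.toSubgroup then subgroupMu H.toSubgroup K else 0)
    (Finset.Icc H.toSubgroup L.toSubgroup)
    (fun K hK => ⟨L.ofLe (ne_bot_of_le_ne_bot H.ne_bot (Finset.mem_Icc.1 hK).1)
      (Finset.mem_Icc.1 hK).2, rfl⟩)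
    (fun K hK => by
      rw [Finset.mem_Icc, and_comm, not_and] at hK
      split_ifs with h
      exacts [subgroupMu_eq_zero (hK h), rfl])
  refine h2.trans (Eq.trans (Finset.sum_congr rfl fun K hK => ?_) (h1.trans ?_))
  · rw [if_pos (Finset.mem_Icc.1 hK).2]; rfl
  · simp only [NonidPSubgroup.ext_iff]

open scoped Classical in
theorem sum_le_subgroupMu_bot [Finite G] (L : NonidPSubgroup p G) :
    ∑ K : NonidPSubgroup p G, (if K ≤ L then subgroupMu ⊥ K.toSubgroup else 0) = -1 := by
  let _ : Fintype (Subgroup G) := Fintype.ofFinite _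
  let _ : LocallyFiniteOrder (Subgroup G) := Fintype.toLocallyFiniteOrder
  have h1 := IncidenceAlgebra.sum_Icc_mu_right (𝕜 := ℚ) ⊥ L.toSubgroup
  -- The values over `[1, L]` add up to `0` because `L ≠ 1`; removing `μ(1, 1) = 1` leaves `-1` on
  -- `(1, L]`.
  rw [← Finset.Ioc_insert_left bot_le, Finset.sum_insert Finset.left_notMem_Ioc,
    IncidenceAlgebra.mu_self, if_neg L.ne_bot.symm] at h1
  have h2 := sum_eq_sum_of_support (p := p)
    (fun K => if K ≤ L.toSubgroup then subgroupMu ⊥ K else 0)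
    (Finset.Ioc ⊥ L.toSubgroup)
    (fun K hK => ⟨L.ofLe (Finset.mem_Ioc.1 hK).1.ne' (Finset.mem_Ioc.1 hK).2, rfl⟩)
    (fun K hK => by
      rw [Finset.mem_Ioc, not_and] at hK
      exact if_neg (hK (bot_lt_iff_ne_bot.2 K.ne_bot)))
  refine h2.trans (Eq.trans (Finset.sum_congr rfl fun K hK => ?_) (eq_neg_of_add_eq_zero_right h1))
  rw [if_pos (Finset.mem_Ioc.1 hK).2]; rfl

theorem sum_subgroupMu_left [Finite G] (L : NonidPSubgroup p G) :
    ∑ K : NonidPSubgroup p G, subgroupMu K.toSubgroup L.toSubgroup =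
      -subgroupMu ⊥ L.toSubgroup := by
  classical
  let _ : Fintype (Subgroup G) := Fintype.ofFinite _
  let _ : LocallyFiniteOrder (Subgroup G) := Fintype.toLocallyFiniteOrder
  have h1 := IncidenceAlgebra.sum_Icc_mu_left (𝕜 := ℚ) ⊥ L.toSubgroup
  rw [← Finset.Ioc_insert_left bot_le, Finset.sum_insert Finset.left_notMem_Ioc,
    if_neg L.ne_bot.symm] at h1
  have h2 := sum_eq_sum_of_support (p := p)
    (fun K => subgroupMu K L.toSubgroup)
    (Finset.Ioc ⊥ L.toSubgroup)
    (fun K hK => ⟨L.ofLe (Finset.mem_Ioc.1 hK).1.ne' (Finset.mem_Ioc.1 hK).2, rfl⟩)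
    (fun K hK => by
      rw [Finset.mem_Ioc, not_and] at hK
      exact subgroupMu_eq_zero (hK (bot_lt_iff_ne_bot.2 K.ne_bot)))
  exact h2.trans (eq_neg_of_add_eq_zero_right h1)

-- The zeta matrix undoes the Möbius transform of an arbitrary `a`; this is the form in which
-- weightings are verified, its mirror image below serving for coweightings.
open scoped Classical in
theorem sum_sum_le_subgroupMu_left [Finite G] (H : NonidPSubgroup p G)
    (a : NonidPSubgroup p G → ℚ) :
    ∑ K : NonidPSubgroup p G, (if H ≤ K then
      ∑ L : NonidPSubgroup p G, subgroupMu K.toSubgroup L.toSubgroup * a L else 0) = a H := by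
  calc _ = ∑ L : NonidPSubgroup p G, (∑ K : NonidPSubgroup p G,
        if H ≤ K then subgroupMu K.toSubgroup L.toSubgroup else 0) * a L := by
        simp_rw [Finset.sum_mul]
        rw [Finset.sum_comm]
        refine Finset.sum_congr rfl fun K _ => ?_
        split_ifs <;> simp
    _ = a H := by simp_rw [sum_le_subgroupMu_left]; simp

open scoped Classical in
theorem sum_sum_le_subgroupMu_right [Finite G] (L : NonidPSubgroup p G)
    (a : NonidPSubgroup p G → ℚ) :
    ∑ K : NonidPSubgroup p G, (if K ≤ L then
      ∑ H : NonidPSubgroup p G, a H * subgroupMu H.toSubgroup K.toSubgroup else 0) = a L := by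
  calc _ = ∑ H : NonidPSubgroup p G, a H * (∑ K : NonidPSubgroup p G,
        if K ≤ L then subgroupMu H.toSubgroup K.toSubgroup else 0) := by
        simp_rw [Finset.mul_sum]
        rw [Finset.sum_comm]
        refine Finset.sum_congr rfl fun K _ => ?_
        split_ifs <;> simp
    _ = a L := by simp_rw [sum_le_subgroupMu_right]; simp

open scoped Classical in
/-- Möbius inversion in the poset of nonidentity `p`-subgroups. -/
theorem moebius_inversion [Finite G] (f g : NonidPSubgroup p G → ℚ)
    (h : ∀ L, g L = ∑ K, if K ≤ L then f K else 0) (K : NonidPSubgroup p G) :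
    f K = ∑ H, g H * subgroupMu H.toSubgroup K.toSubgroup := by
  calc f K = ∑ L, f L * (if L = K then 1 else 0) := by simp
    _ = ∑ L, f L * ∑ H : NonidPSubgroup p G,
          (if L ≤ H then subgroupMu H.toSubgroup K.toSubgroup else 0) := by
        simp_rw [sum_le_subgroupMu_left]
    _ = ∑ H, g H * subgroupMu H.toSubgroup K.toSubgroup := by
        simp_rw [h, Finset.sum_mul, Finset.mul_sum]
        rw [Finset.sum_comm]
        refine Finset.sum_congr rfl fun K _ => Finset.sum_congr rfl fun L _ => ?_
        split_ifs <;> simp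

end NonidPSubgroup

end MoebiusSums

/-! ### Conjugation of nonidentity `p`-subgroups -/

section Conjugation

variable {p : ℕ} {G : Type*} [Group G]

theorem mem_conjBy {H : Subgroup G} {g x : G} : x ∈ conjBy H g ↔ g * x * g⁻¹ ∈ H := by
  rw [conjBy, Subgroup.mem_map]
  constructor
  · rintro ⟨y, hy, rfl⟩
    simpa [mul_assoc] using hy
  · exact fun h => ⟨_, h, by simp [mul_assoc]⟩

theorem conjBy_mul (H : Subgroup G) (g k : G) : conjBy (conjBy H g) k = conjBy H (g * k) := by
  ext x
  simp [mem_conjBy, mul_assoc]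

theorem conjBy_one (H : Subgroup G) : conjBy H 1 = H := by
  ext x
  simp [mem_conjBy]

theorem conjBy_mono {H K : Subgroup G} (h : H ≤ K) (g : G) : conjBy H g ≤ conjBy K g :=
  Subgroup.map_mono h

theorem card_conjBy (H : Subgroup G) (g : G) : Nat.card (conjBy H g) = Nat.card H :=
  Nat.card_congr (H.equivMapOfInjective _ (MulAut.conj g⁻¹).injective).symm.toEquiv

theorem isCyclic_conjBy (H : Subgroup G) (g : G) : IsCyclic (conjBy H g) ↔ IsCyclic H :=
  (H.equivMapOfInjective _ (MulAut.conj g⁻¹).injective).isCyclic.symm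

theorem conjBy_centralizer (H : Subgroup G) (g : G) :
    Subgroup.centralizer (conjBy H g : Set G) = conjBy (Subgroup.centralizer (H : Set G)) g := by
  -- One inclusion, for all `H` and `g`, suffices: applied to `H ^ g` and `g⁻¹`, then conjugated
  -- back by `g`, it gives the reverse one.
  have key : ∀ (H : Subgroup G) (g : G), conjBy (Subgroup.centralizer (H : Set G)) g ≤
      Subgroup.centralizer (conjBy H g : Set G) := by
    intro H g
    rw [conjBy_le_iff]
    intro c hc
    have := centralizer_conj_mem (H := conjBy H g) (K := H) (g := g⁻¹)
      (by rw [conjBy_mul, mul_inv_cancel, conjBy_one]) hc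
    simpa using this
  refine le_antisymm ?_ (key H g)
  have := conjBy_mono (key (conjBy H g) g⁻¹) g
  rwa [conjBy_mul, conjBy_mul, inv_mul_cancel, conjBy_one, mul_inv_cancel, conjBy_one] at this

theorem conjBy_pResidualCentralizer (H : Subgroup G) (g : G) :
    pResidualCentralizer p (conjBy H g) = conjBy (pResidualCentralizer p H) g := by
  have key : ∀ (H : Subgroup G) (g : G), conjBy (pResidualCentralizer p H) g ≤
      pResidualCentralizer p (conjBy H g) := by
    intro H g
    rw [conjBy_le_iff]
    intro c hc
    have := pResidualCentralizer_conj_mem p (H := conjBy H g) (K := H) (g := g⁻¹)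
      (by rw [conjBy_mul, mul_inv_cancel, conjBy_one]) hc
    simpa using this
  refine le_antisymm ?_ (key H g)
  have := conjBy_mono (key (conjBy H g) g⁻¹) g
  rwa [conjBy_mul, conjBy_mul, inv_mul_cancel, conjBy_one, mul_inv_cancel, conjBy_one] at this

namespace NonidPSubgroup

/-- The conjugate `H ^ g` of a nonidentity `p`-subgroup. -/
def conj (H : NonidPSubgroup p G) (g : G) : NonidPSubgroup p G :=
  ⟨conjBy H.toSubgroup g, H.isPGroup.map _, fun h => H.ne_bot <|
    (Subgroup.map_eq_bot_iff_of_injective _ (MulAut.conj g⁻¹).injective).1 h⟩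

theorem conj_conj (H : NonidPSubgroup p G) (g k : G) : (H.conj g).conj k = H.conj (g * k) :=
  NonidPSubgroup.ext (conjBy_mul _ _ _)

theorem conj_one (H : NonidPSubgroup p G) : H.conj 1 = H := NonidPSubgroup.ext (conjBy_one _)

/-- Conjugation by `g` as a permutation of the nonidentity `p`-subgroups. -/
@[simps]
def conjEquiv (g : G) : NonidPSubgroup p G ≃ NonidPSubgroup p G where
  toFun H := H.conj g
  invFun H := H.conj g⁻¹
  left_inv H := by simp [conj_conj, conj_one]
  right_inv H := by simp [conj_conj, conj_one]

theorem conj_le_iff {H K : NonidPSubgroup p G} {g : G} : H.conj g ≤ K ↔ H ≤ K.conj g⁻¹ := by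
  constructor <;> intro h
  · simpa [le_def, conj, conjBy_mul, conjBy_one] using conjBy_mono h g⁻¹
  · simpa [le_def, conj, conjBy_mul, conjBy_one] using conjBy_mono h g

theorem conj_le_conj_iff {H K : NonidPSubgroup p G} {g : G} : H.conj g ≤ K.conj g ↔ H ≤ K := by
  rw [conj_le_iff, conj_conj, mul_inv_cancel, conj_one]

theorem conjClass_eq_iff {H K : NonidPSubgroup p G} :
    H.conjClass = K.conjClass ↔ ∃ g, H.conj g = K :=
  Quotient.eq.trans (exists_congr fun _ => (NonidPSubgroup.ext_iff (x := H.conj _)).symm)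

/-- As functions of `K`, both sides have sum `-1` over the nonidentity `K ≤ L` for each `L`, and
Möbius inversion shows that this system has only one solution. -/
theorem subgroupMu_bot_conj [Finite G] (K : NonidPSubgroup p G) (g : G) :
    subgroupMu ⊥ (K.conj g).toSubgroup = subgroupMu ⊥ K.toSubgroup := by
  classical
  have := moebius_inversion (p := p) (fun K => subgroupMu ⊥ (K.conj g).toSubgroup) (fun _ => -1)
    (fun L => by
      rw [← sum_le_subgroupMu_bot (L.conj g), ← (conjEquiv g).sum_comp]
      simp [conj_le_conj_iff]) K
  simp only [neg_mul, one_mul, Finset.sum_neg_distrib, sum_subgroupMu_left, neg_neg] at this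
  exact this

end NonidPSubgroup

end Conjugation

/-! ### Counting morphisms -/

section MorphismCounts

variable {p : ℕ} {G : Type*} [Group G]

/-- The number of double cosets `A x B` in a union `X` of such, by Burnside's lemma. -/
theorem card_quot_doubleCoset_mul [Finite G] (X : Set G) (A B : Subgroup G) [Fintype B]
    (hX : ∀ a ∈ A, ∀ b ∈ B, ∀ x ∈ X, a * x * b ∈ X) (r : X → X → Prop)
    (hr : ∀ x y, r x y ↔ ∃ a ∈ A, ∃ b ∈ B, (y : G) = a * x * b) :
    Nat.card (Quot r) * (Nat.card A * Nat.card B) =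
      ∑ b : B, Nat.card {x : X // (x : G) * b * (x : G)⁻¹ ∈ A} := by
  classical
  let _ : Fintype A := Fintype.ofFinite _
  let _ : MulAction (A × B) X :=
    { smul := fun c x => ⟨c.1 * x * (c.2 : G)⁻¹, hX _ c.1.2 _ (inv_mem c.2.2) _ x.2⟩
      one_smul := fun x => Subtype.ext (by simp [HSMul.hSMul])
      mul_smul := fun c d x => Subtype.ext (by simp [HSMul.hSMul, mul_assoc]) }
  have smul_def : ∀ (c : A × B) (x : X), ((c • x : X) : G) = c.1 * x * (c.2 : G)⁻¹ :=
    fun _ _ => rfl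
  let _ : ∀ c : A × B, Fintype (MulAction.fixedBy X c) := fun _ => Fintype.ofFinite _
  let _ : Fintype (Quotient (MulAction.orbitRel (A × B) X)) := Fintype.ofFinite _
  have burnside := MulAction.sum_card_fixedBy_eq_card_orbits_mul_card_group (A × B) X
  have e : Nat.card (Quot r) = Fintype.card (Quotient (MulAction.orbitRel (A × B) X)) := by
    rw [← Nat.card_eq_fintype_card]
    refine Nat.card_congr (Quot.congrRight fun x y => (hr x y).trans ?_)
    rw [MulAction.orbitRel_apply, MulAction.mem_orbit_iff]
    constructor
    · rintro ⟨a, ha, b, hb, h⟩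
      exact ⟨(⟨a⁻¹, inv_mem ha⟩, ⟨b, hb⟩), Subtype.ext (by simp [smul_def, h, mul_assoc])⟩
    · rintro ⟨c, rfl⟩
      exact ⟨(c.1 : G)⁻¹, inv_mem c.1.2, c.2, c.2.2, by simp [smul_def, mul_assoc]⟩
  rw [e, Nat.card_eq_fintype_card, Nat.card_eq_fintype_card, ← Fintype.card_prod, ← burnside,
    Fintype.sum_prod_type_right]
  refine Finset.sum_congr rfl fun b _ => ?_
  simp_rw [← Nat.card_eq_fintype_card]
  rw [← Nat.card_sigma]
  -- The action is `(a, b) • x = a * x * b⁻¹`, so for a fixed `b` each `x` is fixed by exactly one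
  -- candidate, `x * b * x⁻¹`, which has to lie in `A`.
  have fixed_iff : ∀ (a : A) (x : X), x ∈ MulAction.fixedBy X (a, b) ↔
      (a : G) = x * b * (x : G)⁻¹ := by
    intro a x
    rw [MulAction.mem_fixedBy, Subtype.ext_iff, smul_def, mul_inv_eq_iff_eq_mul,
      eq_mul_inv_iff_mul_eq]
  exact Nat.card_congr
    { toFun := fun s => ⟨s.2.1, by rw [← (fixed_iff _ _).1 s.2.2]; exact s.1.2⟩
      invFun := fun x => ⟨⟨_, x.2⟩, x.1, (fixed_iff _ _).2 rfl⟩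
      left_inv := by
        rintro ⟨a, x, hx⟩
        have h := (fixed_iff _ _).1 hx
        obtain ⟨a, ha⟩ := a
        subst h
        rfl
      right_inv := fun _ => rfl }

/-- The order of the transporter `N_G(H, K)`. -/
noncomputable def transporterCard (H K : NonidPSubgroup p G) : ℕ :=
  Nat.card {g : G // conjBy H.toSubgroup g ≤ K.toSubgroup}

open scoped Classical in
theorem transporterCard_eq_sum [Fintype G] (H K : NonidPSubgroup p G) :
    (transporterCard H K : ℚ) = ∑ g : G, if H.conj g ≤ K then 1 else 0 := by
  rw [transporterCard, Nat.card_eq_fintype_card, Fintype.card_subtype, Finset.sum_boole]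
  rfl

/-- Common source of all the morphism counts: `A` or `B` is taken trivial for the one-sided
quotients. The bounds on `A` and `B` make `N_G(H, K)` stable under both multiplications. -/
theorem card_quotient_hom_mul [Finite G] (r : HomRel (TransporterCat p G))
    [CategoryTheory.Congruence r] (H K : NonidPSubgroup p G) (A B : Subgroup G) [Fintype B]
    (hA : A ≤ Subgroup.centralizer (H.toSubgroup : Set G)) (hB : B ≤ K.toSubgroup)
    (hr : ∀ f g : (TransporterCat.mk H ⟶ TransporterCat.mk K),
      r f g ↔ ∃ a ∈ A, ∃ b ∈ B, g.1 = a * f.1 * b) :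
    Nat.card (H.toQuot r ⟶ K.toQuot r) * (Nat.card A * Nat.card B) =
      ∑ b : B, Nat.card {x : {g : G // conjBy H.toSubgroup g ≤ K.toSubgroup} //
        (x : G) * b * (x : G)⁻¹ ∈ A} := by
  have hX : ∀ a ∈ A, ∀ b ∈ B, ∀ x ∈ {g : G | conjBy H.toSubgroup g ≤ K.toSubgroup},
      a * x * b ∈ {g : G | conjBy H.toSubgroup g ≤ K.toSubgroup} := by
    intro a ha b hb x hx
    refine conjBy_le_iff.2 fun h hh => ?_
    have h1 := conjBy_le_iff.1 hx h hh
    have h2 := Subgroup.mem_centralizer_iff.1 (hA ha) h hh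
    have h3 : (a * x * b)⁻¹ * h * (a * x * b) = b⁻¹ * (x⁻¹ * h * x) * b := by
      calc _ = b⁻¹ * x⁻¹ * a⁻¹ * (h * a) * x * b := by group
        _ = _ := by rw [h2]; group
    rw [h3]
    exact mul_mem (mul_mem (inv_mem (hB hb)) h1) (hB hb)
  have := card_quot_doubleCoset_mul {g : G | conjBy H.toSubgroup g ≤ K.toSubgroup} A B hX
    (fun f g => r (X := TransporterCat.mk H) (Y := TransporterCat.mk K) f g) hr
  have e : Nat.card (H.toQuot r ⟶ K.toQuot r) =
      Nat.card (Quot (@r (TransporterCat.mk H) (TransporterCat.mk K))) := by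
    change Nat.card (Quot (@CategoryTheory.HomRel.CompClosure _ _ r _ _)) = _
    -- A congruence is its own closure under composition, so morphisms are exactly the `r`-classes.
    rw [CategoryTheory.HomRel.compClosure_eq_self]
  rw [e]
  exact this

theorem card_hom_mul_left [Finite G] (r : HomRel (TransporterCat p G))
    [CategoryTheory.Congruence r] (H K : NonidPSubgroup p G) (A : Subgroup G)
    (hA : A ≤ Subgroup.centralizer (H.toSubgroup : Set G))
    (hr : ∀ f g : (TransporterCat.mk H ⟶ TransporterCat.mk K),
      r f g ↔ ∃ a ∈ A, g.1 = a * f.1) :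
    Nat.card (H.toQuot r ⟶ K.toQuot r) * Nat.card A = transporterCard H K := by
  classical
  have := card_quotient_hom_mul r H K A ⊥ hA bot_le (by simpa using hr)
  rw [Subgroup.card_bot, mul_one] at this
  rw [this, Fintype.sum_unique, transporterCard]
  refine Nat.card_congr (Equiv.subtypeUnivEquiv fun x => ?_)
  rw [show ((default : (⊥ : Subgroup G)) : G) = 1 from rfl, mul_one, mul_inv_cancel]
  exact one_mem A

theorem card_hom_linking_mul [Finite G] (H K : NonidPSubgroup p G) :
    Nat.card (H.toQuot (linkingRel p G) ⟶ K.toQuot (linkingRel p G)) *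
      Nat.card (pResidualCentralizer p H.toSubgroup) = transporterCard H K :=
  card_hom_mul_left _ H K _ (Subgroup.map_subtype_le _) fun _ _ => Iff.rfl

theorem card_hom_frobenius_mul [Finite G] (H K : NonidPSubgroup p G) :
    Nat.card (H.toQuot (frobeniusRel p G) ⟶ K.toQuot (frobeniusRel p G)) *
      Nat.card (Subgroup.centralizer (H.toSubgroup : Set G)) = transporterCard H K :=
  card_hom_mul_left _ H K _ le_rfl fun _ _ => Iff.rfl

theorem card_hom_orbit_mul [Finite G] (H K : NonidPSubgroup p G) :
    Nat.card (H.toQuot (orbitRel p G) ⟶ K.toQuot (orbitRel p G)) *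
      Nat.card K.toSubgroup = transporterCard H K := by
  classical
  let _ : Fintype K.toSubgroup := Fintype.ofFinite _
  have := card_quotient_hom_mul (orbitRel p G) H K ⊥ K.toSubgroup bot_le le_rfl
    (by simp [orbitRel])
  rw [Subgroup.card_bot, one_mul] at this
  -- The right action of `K` is free: `x * b * x⁻¹ = 1` forces `b = 1`.
  rw [this, Finset.sum_eq_single 1, transporterCard]
  · exact Nat.card_congr (Equiv.subtypeUnivEquiv fun x => by simp)
  · intro b _ hb
    have : IsEmpty {x : {g : G // conjBy H.toSubgroup g ≤ K.toSubgroup} //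
        (x : G) * b * (x : G)⁻¹ ∈ (⊥ : Subgroup G)} :=
      ⟨fun x => hb (by simpa [Subgroup.mem_bot] using x.2)⟩
    exact Nat.card_of_isEmpty
  · simp

/-- The centralizer `C_K(b)` of an element `b` of a nonidentity `p`-subgroup `K`. -/
def NonidPSubgroup.centralizerOf (K : NonidPSubgroup p G) (b : K.toSubgroup) :
    NonidPSubgroup p G :=
  K.ofLe (H := K.toSubgroup ⊓ Subgroup.centralizer {(b : G)}) (by
    -- Since `b` lies in `C_K(b)`, triviality of `C_K(b)` would give `b = 1`, and then `C_K(b) = K ≠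
    -- 1`.
    intro h
    have hb : (b : G) ∈ K.toSubgroup ⊓ Subgroup.centralizer {(b : G)} :=
      ⟨b.2, Subgroup.mem_centralizer_iff.2 (by simp)⟩
    have hb1 : (b : G) = 1 := by rwa [h, Subgroup.mem_bot] at hb
    refine K.ne_bot (le_bot_iff.1 (h ▸ le_inf le_rfl fun x _ => ?_))
    rw [Subgroup.mem_centralizer_iff]
    simp [hb1]) inf_le_left

/-- In Burnside's count, `g * b * g⁻¹` centralizes `H` exactly when `H ^ g` centralizes `b`. The
transporter elements counted for `b` thus form `N_G(H, C_K(b))`, which has `|C_G(H)|` elements per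
Frobenius morphism. -/
theorem card_hom_exterior_mul [Finite G] (H K : NonidPSubgroup p G) [Fintype K.toSubgroup] :
    Nat.card (H.toQuot (exteriorRel p G) ⟶ K.toQuot (exteriorRel p G)) *
      Nat.card K.toSubgroup = ∑ b : K.toSubgroup,
        Nat.card (H.toQuot (frobeniusRel p G) ⟶ (K.centralizerOf b).toQuot (frobeniusRel p G)) := by
  refine Nat.eq_of_mul_eq_mul_right
    (Nat.card_pos (α := Subgroup.centralizer (H.toSubgroup : Set G))) ?_
  rw [mul_assoc, mul_comm (Nat.card K.toSubgroup), Finset.sum_mul]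
  simp_rw [card_hom_frobenius_mul]
  rw [card_quotient_hom_mul (exteriorRel p G) H K (Subgroup.centralizer (H.toSubgroup : Set G))
    K.toSubgroup le_rfl le_rfl fun _ _ => Iff.rfl]
  refine Finset.sum_congr rfl fun b _ => ?_
  refine Nat.card_congr ((Equiv.subtypeSubtypeEquivSubtypeInter
    (fun g => conjBy H.toSubgroup g ≤ K.toSubgroup)
    (fun g => g * b * g⁻¹ ∈ Subgroup.centralizer (H.toSubgroup : Set G))).trans
    (Equiv.subtypeEquivRight fun g => ?_))
  rw [NonidPSubgroup.centralizerOf, NonidPSubgroup.ofLe, le_inf_iff]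
  refine and_congr_right fun _ => ?_
  rw [conjBy_le_iff, Subgroup.mem_centralizer_iff]
  refine forall₂_congr fun h _ => ?_
  rw [Subgroup.mem_centralizer_iff]
  simp only [Set.mem_singleton_iff, forall_eq]
  constructor <;> intro e
  · calc (b : G) * (g⁻¹ * h * g) = g⁻¹ * (g * b * g⁻¹ * h) * g := by group
      _ = g⁻¹ * h * g * b := by rw [← e]; group
  · calc h * (g * b * g⁻¹) = g * (g⁻¹ * h * g * b) * g⁻¹ := by group
      _ = g * b * g⁻¹ * h := by rw [← e]; group

end MorphismCounts

/-! ### Weightings and coweightings -/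

section Weightings

variable {p : ℕ} {G : Type*} [Group G] [Finite G]

/-- For each single `g`, Möbius inversion evaluates the sum over the `K` containing `H ^ g` to `a (H
^ g) = a H`. -/
theorem sum_transporterCard_mul (H : NonidPSubgroup p G) (a : NonidPSubgroup p G → ℚ)
    (ha : ∀ K g, a (K.conj g) = a K) :
    ∑ K, (transporterCard H K : ℚ) *
      ∑ L : NonidPSubgroup p G, subgroupMu K.toSubgroup L.toSubgroup * a L =
      Nat.card G * a H := by
  classical
  let _ : Fintype G := Fintype.ofFinite G
  simp_rw [transporterCard_eq_sum, Finset.sum_mul]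
  rw [Finset.sum_comm]
  simp_rw [ite_mul, one_mul, zero_mul, NonidPSubgroup.sum_sum_le_subgroupMu_left, ha]
  simp

/-- The condition `K ^ g ≤ L` means `K ≤ L ^ g⁻¹`, so each `g` contributes `a (L ^ g⁻¹) = a L`. -/
theorem sum_mul_transporterCard (f a : NonidPSubgroup p G → ℚ)
    (hf : ∀ L, (∑ K, open Classical in if K ≤ L then f K else 0) = a L)
    (ha : ∀ K g, a (K.conj g) = a K) (L : NonidPSubgroup p G) :
    ∑ K, f K * (transporterCard K L : ℚ) = Nat.card G * a L := by
  classical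
  let _ : Fintype G := Fintype.ofFinite G
  simp_rw [transporterCard_eq_sum, Finset.mul_sum]
  rw [Finset.sum_comm]
  simp_rw [mul_ite, mul_one, mul_zero, NonidPSubgroup.conj_le_iff, hf, ha]
  simp

theorem sum_transporterCat (f : TransporterCat p G → ℚ) :
    ∑ K, f K = ∑ K : NonidPSubgroup p G, f ⟨K⟩ :=
  Fintype.sum_equiv ⟨TransporterCat.sub, TransporterCat.mk, fun _ => rfl, fun _ => rfl⟩ _ _
    fun _ => rfl

theorem sum_quotient (r : HomRel (TransporterCat p G)) (f : CategoryTheory.Quotient r → ℚ) :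
    ∑ K, f K = ∑ K : NonidPSubgroup p G, f (K.toQuot r) :=
  Fintype.sum_equiv ⟨fun K => K.as.sub, fun K => K.toQuot r, fun _ => rfl, fun _ => rfl⟩ _ _
    fun _ => rfl

open scoped Classical in
theorem card_hom_poset (H K : NonidPSubgroup p G) :
    (Nat.card (H ⟶ K) : ℚ) = if H ≤ K then 1 else 0 := by
  split_ifs with h
  · have : Unique (H ⟶ K) := ⟨⟨CategoryTheory.homOfLE h⟩, fun _ => Subsingleton.elim _ _⟩
    simp
  · have : IsEmpty (H ⟶ K) := ⟨fun f => h (CategoryTheory.leOfHom f)⟩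
    simp

omit [Finite G] in
theorem card_hom_transporter (H K : NonidPSubgroup p G) :
    Nat.card (TransporterCat.mk H ⟶ TransporterCat.mk K) = transporterCard H K := rfl

theorem card_ne_zero_rat (X : Type*) [Nonempty X] [Finite X] : (Nat.card X : ℚ) ≠ 0 :=
  Nat.cast_ne_zero.2 Nat.card_pos.ne'

theorem isWeighting_poset : IsWeighting (NonidPSubgroup p G) (fun H =>
    ∑ K : NonidPSubgroup p G, subgroupMu H.toSubgroup K.toSubgroup) := by
  classical
  intro H
  simp_rw [card_hom_poset, ite_mul, one_mul, zero_mul]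
  simpa using NonidPSubgroup.sum_sum_le_subgroupMu_left H fun _ => 1

theorem isCoweighting_poset :
    IsCoweighting (NonidPSubgroup p G) (fun K => -subgroupMu ⊥ K.toSubgroup) := by
  classical
  intro L
  simp_rw [card_hom_poset, mul_ite, mul_one, mul_zero]
  have := NonidPSubgroup.sum_le_subgroupMu_bot L
  rw [← neg_eq_iff_eq_neg, ← Finset.sum_neg_distrib] at this
  rw [← this]
  exact Finset.sum_congr rfl fun K _ => by split_ifs <;> simp

theorem isWeighting_transporter : IsWeighting (TransporterCat p G) (fun H =>
    (Nat.card G : ℚ)⁻¹ * ∑ K : NonidPSubgroup p G,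
      subgroupMu H.sub.toSubgroup K.toSubgroup) := by
  rintro ⟨H⟩
  rw [sum_transporterCat]
  simp_rw [card_hom_transporter, mul_left_comm _ (Nat.card G : ℚ)⁻¹]
  have := sum_transporterCard_mul H (fun _ => 1) fun _ _ => rfl
  simp only [mul_one] at this
  rw [← Finset.mul_sum, this, inv_mul_cancel₀ (card_ne_zero_rat G)]

theorem sum_bot_mul_transporterCard (L : NonidPSubgroup p G) :
    ∑ K : NonidPSubgroup p G, subgroupMu ⊥ K.toSubgroup * (transporterCard K L : ℚ) =
      -Nat.card G := by
  have := sum_mul_transporterCard (fun K => subgroupMu ⊥ K.toSubgroup) (fun _ => -1)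
    NonidPSubgroup.sum_le_subgroupMu_bot (fun _ _ => rfl) L
  rw [this, mul_neg_one]

theorem isCoweighting_transporter : IsCoweighting (TransporterCat p G) (fun K =>
    -(Nat.card G : ℚ)⁻¹ * subgroupMu ⊥ K.sub.toSubgroup) := by
  rintro ⟨L⟩
  rw [sum_transporterCat]
  simp_rw [card_hom_transporter, mul_assoc]
  rw [← Finset.mul_sum, sum_bot_mul_transporterCard, neg_mul_neg,
    inv_mul_cancel₀ (card_ne_zero_rat G)]

section LeftQuotient

variable (r : HomRel (TransporterCat p G)) (a : NonidPSubgroup p G → ℕ)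

/-- Here `a H` is the order of the group divided out on the left. After multiplication by `a H`, the
weighting equation asks the transporter matrix to return `|G| a`, so the solution is the Möbius
transform of `a`. -/
theorem isWeighting_of_card_mul_left (ha0 : ∀ K, a K ≠ 0) (ha : ∀ K g, a (K.conj g) = a K)
    (hr : ∀ H K : NonidPSubgroup p G,
      Nat.card (H.toQuot r ⟶ K.toQuot r) * a H = transporterCard H K) :
    IsWeighting (CategoryTheory.Quotient r) (fun H => (Nat.card G : ℚ)⁻¹ *
      ∑ K : NonidPSubgroup p G, subgroupMu H.as.sub.toSubgroup K.toSubgroup * (a K : ℚ)) := by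
  rintro ⟨⟨H⟩⟩
  rw [sum_quotient]
  refine mul_right_cancel₀ (Nat.cast_ne_zero.2 (ha0 H) : (a H : ℚ) ≠ 0) ?_
  have := sum_transporterCard_mul H (fun K => (a K : ℚ)) fun K g => by rw [ha]
  simp_rw [← hr, Nat.cast_mul] at this
  rw [Finset.sum_mul, one_mul]
  refine Eq.trans ?_ ((congrArg ((Nat.card G : ℚ)⁻¹ * ·) this).trans
    (inv_mul_cancel_left₀ (card_ne_zero_rat G) _))
  dsimp only
  rw [Finset.mul_sum]
  exact Finset.sum_congr rfl fun K _ => by ring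

/-- The divisor depends on the source, the index summed over in a coweighting, so the transporter
coweighting only has to be multiplied by `a`. -/
theorem isCoweighting_of_card_mul_left
    (hr : ∀ H K : NonidPSubgroup p G,
      Nat.card (H.toQuot r ⟶ K.toQuot r) * a H = transporterCard H K) :
    IsCoweighting (CategoryTheory.Quotient r) (fun K => -(Nat.card G : ℚ)⁻¹ *
      subgroupMu ⊥ K.as.sub.toSubgroup * (a K.as.sub : ℚ)) := by
  rintro ⟨⟨L⟩⟩
  have := sum_bot_mul_transporterCard L
  simp_rw [← hr, Nat.cast_mul] at this
  rw [sum_quotient, ← inv_mul_cancel₀ (card_ne_zero_rat G), ← neg_mul_neg, ← this, Finset.mul_sum]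
  exact Finset.sum_congr rfl fun K _ => by ring

end LeftQuotient

theorem isWeighting_orbit : IsWeighting (OrbitCat p G) (fun H => (Nat.card G : ℚ)⁻¹ *
    (Nat.card H.as.sub.toSubgroup : ℚ) *
      ∑ K : NonidPSubgroup p G, subgroupMu H.as.sub.toSubgroup K.toSubgroup) := by
  rintro ⟨⟨H⟩⟩
  rw [sum_quotient]
  have := sum_transporterCard_mul H (fun _ => 1) fun _ _ => rfl
  simp_rw [mul_one, ← card_hom_orbit_mul, Nat.cast_mul] at this
  rw [← inv_mul_cancel₀ (card_ne_zero_rat G), ← this, Finset.mul_sum]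
  exact Finset.sum_congr rfl fun K _ => by ring

/-- The divisor `|L|` belongs to the target, so the equation becomes the transporter equation with
right-hand side `|L|`, whence the transform of the order function. -/
theorem isCoweighting_orbit : IsCoweighting (OrbitCat p G) (fun K => (Nat.card G : ℚ)⁻¹ *
    ∑ H : NonidPSubgroup p G, (Nat.card H.toSubgroup : ℚ) *
      subgroupMu H.toSubgroup K.as.sub.toSubgroup) := by
  rintro ⟨⟨L⟩⟩
  have := sum_mul_transporterCard
    (fun K => ∑ H : NonidPSubgroup p G, (Nat.card H.toSubgroup : ℚ) *
      subgroupMu H.toSubgroup K.toSubgroup) (fun K => (Nat.card K.toSubgroup : ℚ))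
    (fun L => NonidPSubgroup.sum_sum_le_subgroupMu_right L _)
    (fun K g => by rw [← card_conjBy K.toSubgroup g]; rfl) L
  simp_rw [← card_hom_orbit_mul, Nat.cast_mul] at this
  rw [sum_quotient]
  refine mul_right_cancel₀ (card_ne_zero_rat L.toSubgroup) ?_
  rw [one_mul, Finset.sum_mul]
  refine Eq.trans ?_ ((congrArg ((Nat.card G : ℚ)⁻¹ * ·) this).trans
    (inv_mul_cancel_left₀ (card_ne_zero_rat G) _))
  dsimp only
  rw [Finset.mul_sum]
  exact Finset.sum_congr rfl fun K _ => by ring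

/-- A coweighting of the Frobenius category is a coweighting of its exterior quotient. -/
theorem IsCoweighting.exterior {k : NonidPSubgroup p G → ℚ}
    (hk : IsCoweighting (FrobeniusCat p G) fun K => k K.as.sub) :
    IsCoweighting (ExteriorCat p G) fun K => k K.as.sub := by
  rintro ⟨⟨L⟩⟩
  let _ : Fintype L.toSubgroup := Fintype.ofFinite _
  rw [sum_quotient]
  refine mul_right_cancel₀ (card_ne_zero_rat L.toSubgroup) ?_
  rw [Finset.sum_mul]
  simp_rw [mul_assoc, ← Nat.cast_mul, card_hom_exterior_mul, Nat.cast_sum, Finset.mul_sum]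
  rw [Finset.sum_comm]
  -- This is the Frobenius coweighting equation at `C_L(b)`; the `|L|` elements `b` contribute `1`
  -- each.
  have : ∀ b : L.toSubgroup, ∑ H : NonidPSubgroup p G, k H *
      (Nat.card (H.toQuot (frobeniusRel p G) ⟶
        (L.centralizerOf b).toQuot (frobeniusRel p G)) : ℚ) = 1 := fun b => by
    have := hk ((L.centralizerOf b).toQuot _)
    rwa [sum_quotient] at this
  simp [this]

end Weightings

/-! ### Existence of weightings for categories triangular with respect to a rank. -/

section EI

universe v u

/-- A finite category all of whose morphisms either strictly increase a rank function or have
isomorphic source and target has a weighting. -/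
theorem exists_isWeighting_of_rank {C : Type u} [CategoryTheory.Category.{v} C] [Fintype C]
    [∀ a b : C, Finite (a ⟶ b)] (rank : C → ℕ)
    (hiso : ∀ a b : C, Nonempty (a ≅ b) → rank a = rank b)
    (hhom : ∀ a b : C, Nonempty (a ⟶ b) → Nonempty (a ≅ b) ∨ rank a < rank b) :
    ∃ k : C → ℚ, IsWeighting C k := by
  classical
  obtain ⟨N, hN⟩ : ∃ N, ∀ a, rank a < N := by
    obtain ⟨N, hN⟩ := (Set.finite_range rank).bddAbove
    exact ⟨N + 1, fun a => Nat.lt_succ_of_le (hN ⟨a, rfl⟩)⟩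
  -- Ranks are bounded, so the recursion can run downwards from the highest rank.
  have wf : WellFounded fun a b : C => rank b < rank a :=
    Subrelation.wf (r := InvImage (· < ·) fun a => N - rank a)
      (fun {a b} h => by
        have h1 := hN a
        have h2 := hN b
        change N - rank a < N - rank b
        omega) (InvImage.wf _ Nat.lt_wfRel.wf)
  -- With `k` constant on isomorphism classes, the weighting equation at `a` involves only that
  -- constant and values at larger rank; it is solved for the constant.
  let k : C → ℚ := wf.fix fun a ih =>
    (1 - ∑ b, if h : rank a < rank b then (Nat.card (a ⟶ b) : ℚ) * ih b h else 0) /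
      ∑ b, if Nonempty (a ≅ b) then (Nat.card (a ⟶ b) : ℚ) else 0
  have hk : ∀ a, k a = (1 - ∑ b, if rank a < rank b then (Nat.card (a ⟶ b) : ℚ) * k b else 0) /
      ∑ b, if Nonempty (a ≅ b) then (Nat.card (a ⟶ b) : ℚ) else 0 := fun a => by
    refine (wf.fix_eq _ a).trans ?_
    simp only [dite_eq_ite]
    rfl
  have hk_iso : ∀ a b, Nonempty (a ≅ b) → k b = k a := by
    rintro a b ⟨e⟩
    have hcard : ∀ c, Nat.card (b ⟶ c) = Nat.card (a ⟶ c) := fun c =>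
      Nat.card_congr (e.symm.homCongr (CategoryTheory.Iso.refl c))
    have hi : ∀ c, Nonempty (b ≅ c) ↔ Nonempty (a ≅ c) := fun c =>
      ⟨fun ⟨f⟩ => ⟨e.trans f⟩, fun ⟨f⟩ => ⟨e.symm.trans f⟩⟩
    rw [hk a, hk b]
    simp_rw [hcard, hi, hiso a b ⟨e⟩]
  refine ⟨k, fun a => ?_⟩
  have hpos : (0 : ℚ) < ∑ b, if Nonempty (a ≅ b) then (Nat.card (a ⟶ b) : ℚ) else 0 := by
    refine Finset.sum_pos' (fun b _ => by split_ifs <;> positivity) ⟨a, Finset.mem_univ _, ?_⟩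
    rw [if_pos ⟨CategoryTheory.Iso.refl a⟩]
    have : Nonempty (a ⟶ a) := ⟨𝟙 a⟩
    exact_mod_cast Nat.card_pos
  have hka := (eq_div_iff hpos.ne').1 (hk a)
  rw [eq_sub_iff_add_eq, Finset.mul_sum, ← Finset.sum_add_distrib] at hka
  rw [← hka]
  refine Finset.sum_congr rfl fun b _ => ?_
  by_cases hi : Nonempty (a ≅ b)
  · rw [if_pos hi, if_neg (hiso a b hi).not_lt, hk_iso a b hi, add_zero, mul_comm]
  · rw [if_neg hi, mul_zero, zero_add]
    by_cases hh : Nonempty (a ⟶ b)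
    · rw [if_pos ((hhom a b hh).resolve_left hi)]
    · have : IsEmpty (a ⟶ b) := not_nonempty_iff.1 hh
      simp

variable {p : ℕ} {G : Type*} [Group G] [Finite G]

theorem NonidPSubgroup.conj_eq_of_card_le {H K : NonidPSubgroup p G} {g : G} (h : H.conj g ≤ K)
    (hc : Nat.card K.toSubgroup ≤ Nat.card H.toSubgroup) : H.conj g = K :=
  NonidPSubgroup.ext (Subgroup.eq_of_le_of_card_ge h (hc.trans (card_conjBy _ _).ge))

/-- The rank is the order of the subgroup: a morphism between subgroups of equal order comes from
some `g` with `H ^ g = K`, which is already invertible in the transporter category. This supplies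
the weighting of the exterior quotient. -/
theorem exists_isWeighting_quotient (r : HomRel (TransporterCat p G)) :
    ∃ k : CategoryTheory.Quotient r → ℚ, IsWeighting (CategoryTheory.Quotient r) k := by
  have hle : ∀ a b : CategoryTheory.Quotient r, (a ⟶ b) →
      ∃ g : G, a.as.sub.conj g ≤ b.as.sub := fun a b f => by
    obtain ⟨f, -⟩ := Quot.exists_rep f
    exact ⟨f.1, f.2⟩
  have hcard : ∀ a b : CategoryTheory.Quotient r, (a ⟶ b) →
      Nat.card a.as.sub.toSubgroup ≤ Nat.card b.as.sub.toSubgroup := fun a b f => by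
    obtain ⟨g, hg⟩ := hle a b f
    exact (card_conjBy _ g).symm.le.trans (Subgroup.card_le_of_le hg)
  refine exists_isWeighting_of_rank (fun K => Nat.card K.as.sub.toSubgroup) ?_ ?_
  · rintro a b ⟨e⟩
    exact le_antisymm (hcard a b e.hom) (hcard b a e.inv)
  · rintro a b ⟨f⟩
    refine or_iff_not_imp_right.2 fun h => ?_
    obtain ⟨g, hg⟩ := hle a b f
    have heq := NonidPSubgroup.conj_eq_of_card_le hg (not_lt.1 h)
    have hinv : conjBy b.as.sub.toSubgroup g⁻¹ ≤ a.as.sub.toSubgroup := by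
      change b.as.sub.conj g⁻¹ ≤ a.as.sub
      rw [← heq, NonidPSubgroup.conj_conj, mul_inv_cancel, NonidPSubgroup.conj_one]
    let e : a.as ≅ b.as :=
      { hom := ⟨g, hg⟩
        inv := ⟨g⁻¹, hinv⟩
        hom_inv_id := Subtype.ext (mul_inv_cancel g)
        inv_hom_id := Subtype.ext (inv_mul_cancel g) }
    exact ⟨(CategoryTheory.Quotient.functor r).mapIso e⟩

end EI

/-! ### Sums over conjugacy classes and over cyclic subgroups -/

section ClassSums

variable {p : ℕ} {G : Type*} [Group G] [Finite G]

namespace NonidPSubgroup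

open scoped Classical in
-- Orbit-stabilizer: by finiteness `H ^ g ≤ H` forces equality, so `N_G(H, H)` is the normalizer.
theorem card_conjClass_mul_transporterCard (H : NonidPSubgroup p G) :
    ((Finset.univ.filter fun K : NonidPSubgroup p G => K.conjClass = H.conjClass).card : ℚ) *
      transporterCard H H = Nat.card G := by
  let _ : Fintype G := Fintype.ofFinite G
  have key : ∀ K ∈ Finset.univ.filter fun K : NonidPSubgroup p G => K.conjClass = H.conjClass,
      (Finset.univ.filter fun g : G => H.conj g = K).card = transporterCard H H := by
    intro K hK
    obtain ⟨k, rfl⟩ := conjClass_eq_iff.1 (Finset.mem_filter.1 hK).2.symm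
    rw [transporterCard, Nat.card_eq_fintype_card, Fintype.card_subtype]
    -- The fibre of `g ↦ H ^ g` over `H ^ k` is the coset `N_G(H, H) * k`.
    refine Finset.card_bij (fun g _ => g * k⁻¹) (fun g hg => ?_)
      (fun _ _ _ _ h => mul_right_cancel h) (fun g hg => ⟨g * k, ?_, by simp⟩)
    · rw [Finset.mem_filter] at hg ⊢
      refine ⟨Finset.mem_univ _, ?_⟩
      have : H.conj (g * k⁻¹) = H := by
        rw [← conj_conj, hg.2, conj_conj, mul_inv_cancel, conj_one]
      exact (congrArg toSubgroup this).le
    · rw [Finset.mem_filter] at hg ⊢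
      refine ⟨Finset.mem_univ _, ?_⟩
      rw [← conj_conj, conj_eq_of_card_le hg.2 le_rfl]
  have h := Finset.card_eq_sum_card_fiberwise (f := fun g : G => H.conj g)
    (s := Finset.univ)
    (t := Finset.univ.filter fun K : NonidPSubgroup p G => K.conjClass = H.conjClass)
    (fun g _ => by simpa using (conjClass_eq_iff.2 ⟨g, rfl⟩ : H.conjClass = _).symm)
  rw [Finset.sum_congr rfl key, Finset.sum_const, smul_eq_mul, Finset.card_univ,
    ← Nat.card_eq_fintype_card] at h
  rw [h, Nat.cast_mul]

theorem transporterCard_self_ne_zero (H : NonidPSubgroup p G) : transporterCard H H ≠ 0 := by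
  intro h
  have := card_conjClass_mul_transporterCard H
  rw [h, Nat.cast_zero, mul_zero] at this
  exact card_ne_zero_rat G this.symm

/-- The sum of a conjugation invariant function, as a sum over conjugacy classes. -/
theorem sum_eq_sum_conjClass (rep : ConjClassesNonidP p G → NonidPSubgroup p G)
    (hrep : ∀ c : ConjClassesNonidP p G, (rep c).conjClass = c) (f : NonidPSubgroup p G → ℚ)
    (hf : ∀ K g, f (K.conj g) = f K) :
    ∑ K, f K = ∑ c, f (rep c) * (Nat.card G / transporterCard (rep c) (rep c)) := by
  classical
  rw [← Finset.sum_fiberwise_of_maps_to (s := Finset.univ) (t := Finset.univ)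
    (g := NonidPSubgroup.conjClass) fun _ _ => Finset.mem_univ _]
  refine Finset.sum_congr rfl fun c _ => ?_
  have h := card_conjClass_mul_transporterCard (rep c)
  rw [hrep] at h
  rw [← h, mul_div_cancel_right₀ _ (Nat.cast_ne_zero.2 (transporterCard_self_ne_zero _)),
    mul_comm, ← nsmul_eq_mul, ← Finset.sum_const]
  refine Finset.sum_congr rfl fun K hK => ?_
  obtain ⟨g, rfl⟩ := conjClass_eq_iff.1 ((hrep c).trans (Finset.mem_filter.1 hK).2.symm)
  exact hf _ _

/-- The class of `K` has `|G| / (e K * a K)` members, so `|G|` and `a K` cancel. In the applications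
`e K` counts endomorphisms and `a K` is the order of the group divided out. -/
theorem sum_mul_subgroupMu_bot_eq_sum_conjClass
    (rep : ConjClassesNonidP p G → NonidPSubgroup p G)
    (hrep : ∀ c : ConjClassesNonidP p G, (rep c).conjClass = c)
    (a e : NonidPSubgroup p G → ℕ) (ha : ∀ K g, a (K.conj g) = a K)
    (he : ∀ K, e K * a K = transporterCard K K) :
    ∑ K : NonidPSubgroup p G, -(Nat.card G : ℚ)⁻¹ * subgroupMu ⊥ K.toSubgroup * (a K : ℚ) =
      ∑ c, -subgroupMu ⊥ (rep c).toSubgroup / (e (rep c) : ℚ) := by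
  rw [sum_eq_sum_conjClass rep hrep _ fun K g => by rw [subgroupMu_bot_conj, ha]]
  refine Finset.sum_congr rfl fun c _ => ?_
  have h0 := transporterCard_self_ne_zero (rep c)
  rw [← he, mul_ne_zero_iff] at h0
  have h1 : (e (rep c) : ℚ) ≠ 0 := Nat.cast_ne_zero.2 h0.1
  have h2 : (a (rep c) : ℚ) ≠ 0 := Nat.cast_ne_zero.2 h0.2
  have h3 := card_ne_zero_rat G
  rw [← he, Nat.cast_mul]
  field_simp

end NonidPSubgroup

end ClassSums

/-! ### Generators of cyclic `p`-subgroups. -/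

section CyclicSubgroups

variable {p : ℕ} {G : Type*} [Group G] [Finite G]

/-- The number of elements generating a subgroup. -/
noncomputable def generatorCard (K : Subgroup G) : ℕ := Nat.card {x : G // Subgroup.zpowers x = K}

/-- Each nonidentity element of `L` generates exactly one nonidentity subgroup of `L`. -/
theorem card_eq_one_add_sum_generatorCard (L : NonidPSubgroup p G) :
    (Nat.card L.toSubgroup : ℚ) - 1 =
      ∑ K : NonidPSubgroup p G,
        open Classical in if K ≤ L then (generatorCard K.toSubgroup : ℚ) else 0 := by
  classical
  let _ : Fintype G := Fintype.ofFinite G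
  rw [← Finset.sum_filter]
  have h1 : ∀ K : Subgroup G, generatorCard K =
      (Finset.univ.filter fun x : G => Subgroup.zpowers x = K).card := fun K => by
    rw [generatorCard, Nat.card_eq_fintype_card, Fintype.card_subtype]
  have h2 : Nat.card L.toSubgroup =
      (insert 1 (Finset.univ.filter fun x : G => x ∈ L.toSubgroup ∧ x ≠ 1)).card := by
    rw [Nat.card_eq_fintype_card, ← Fintype.card_coe]
    refine Fintype.card_congr (Equiv.subtypeEquivRight fun x => ?_)
    by_cases hx : x = 1
    · simp [hx]
    · simp [hx]
  have h3 : (Finset.univ.filter fun x : G => x ∈ L.toSubgroup ∧ x ≠ 1) =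
      (Finset.univ.filter fun K : NonidPSubgroup p G => K ≤ L).biUnion fun K =>
        Finset.univ.filter fun x : G => Subgroup.zpowers x = K.toSubgroup := by
    ext x
    simp only [Finset.mem_filter, Finset.mem_univ, true_and, Finset.mem_biUnion]
    constructor
    · rintro ⟨hx, hx1⟩
      exact ⟨L.ofLe (Subgroup.zpowers_ne_bot.2 hx1) (Subgroup.zpowers_le.2 hx),
        Subgroup.zpowers_le.2 hx, rfl⟩
    · rintro ⟨K, hK, hx⟩
      exact ⟨hK (hx ▸ Subgroup.mem_zpowers x), fun h1 => K.ne_bot (by rw [← hx, h1]; simp)⟩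
  rw [h2, Finset.card_insert_of_notMem (by simp), h3, Finset.card_biUnion]
  · simp [h1]
  · intro K _ K' _ hne
    refine Finset.disjoint_left.2 fun x hx hx' => hne (NonidPSubgroup.ext ?_)
    exact (Finset.mem_filter.1 hx).2.symm.trans (Finset.mem_filter.1 hx').2

omit [Finite G] in
theorem generatorCard_of_not_isCyclic {K : Subgroup G} (hK : ¬IsCyclic K) :
    generatorCard K = 0 := by
  have : IsEmpty {x : G // Subgroup.zpowers x = K} := ⟨by
    rintro ⟨x, rfl⟩
    exact hK inferInstance⟩
  exact Nat.card_of_isEmpty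

theorem generatorCard_of_isCyclic {K : Subgroup G} [IsCyclic K] :
    generatorCard K = (Nat.card K).totient := by
  classical
  let _ : Fintype K := Fintype.ofFinite _
  rw [← IsCyclic.card_orderOf_eq_totient (α := K) (d := Nat.card K)
    (by rw [Nat.card_eq_fintype_card]), generatorCard, ← Fintype.card_subtype,
    ← Nat.card_eq_fintype_card]
  refine Nat.card_congr
    { toFun := fun x => ⟨⟨x.1, x.2.le (Subgroup.mem_zpowers _)⟩, ?_⟩
      invFun := fun x => ⟨x.1, ?_⟩
      left_inv := fun _ => rfl
      right_inv := fun _ => rfl }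
  · rw [Subgroup.orderOf_mk, ← Nat.card_zpowers, x.2]
  · refine Subgroup.eq_of_le_of_card_ge (Subgroup.zpowers_le.2 x.1.2) ?_
    rw [Nat.card_zpowers, Subgroup.orderOf_coe, x.2]

open scoped Classical in
theorem NonidPSubgroup.generatorCard_eq (hp : p.Prime) (K : NonidPSubgroup p G) :
    (generatorCard K.toSubgroup : ℚ) =
      if IsCyclic K.toSubgroup then ((p : ℚ) - 1) / p * Nat.card K.toSubgroup else 0 := by
  split_ifs with h
  · have : Fact p.Prime := ⟨hp⟩
    obtain ⟨n, hn⟩ := IsPGroup.iff_card.1 K.isPGroup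
    -- The exponent must be positive: `φ(p ^ n) = (p - 1) / p * p ^ n` fails at `n = 0`.
    have hn0 : n ≠ 0 := by
      rintro rfl
      exact K.ne_bot (Subgroup.card_eq_one.1 (by simpa using hn))
    obtain ⟨n, rfl⟩ := Nat.exists_eq_succ_of_ne_zero hn0
    rw [generatorCard_of_isCyclic, hn, Nat.totient_prime_pow_succ hp]
    have hp0 : (p : ℚ) ≠ 0 := Nat.cast_ne_zero.2 hp.ne_zero
    push_cast [hp.one_le]
    rw [pow_succ]
    field_simp
  · rw [generatorCard_of_not_isCyclic h, Nat.cast_zero]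

-- Möbius inversion of the generator count of `L`, which is `|L| - 1`; the constant `-1` accounts
-- for the term `-μ(1, K)`.
open scoped Classical in
theorem NonidPSubgroup.sum_card_mul_subgroupMu (hp : p.Prime) (K : NonidPSubgroup p G) :
    ∑ H : NonidPSubgroup p G, (Nat.card H.toSubgroup : ℚ) *
      subgroupMu H.toSubgroup K.toSubgroup = -subgroupMu ⊥ K.toSubgroup +
        if IsCyclic K.toSubgroup then ((p : ℚ) - 1) / p * Nat.card K.toSubgroup else 0 := by
  rw [← generatorCard_eq hp, moebius_inversion (fun K => (generatorCard K.toSubgroup : ℚ)) _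
    card_eq_one_add_sum_generatorCard K]
  simp_rw [sub_mul, one_mul, Finset.sum_sub_distrib, sum_subgroupMu_left]
  ring

end CyclicSubgroups

/-! ### Euler characteristics of the six categories. -/

section EulerCharacteristics

variable {p : ℕ} {G : Type*} [Group G] [Finite G]

namespace NonidPSubgroup

omit [Finite G] in
theorem card_pResidualCentralizer_conj (K : NonidPSubgroup p G) (g : G) :
    Nat.card (pResidualCentralizer p (K.conj g).toSubgroup) =
      Nat.card (pResidualCentralizer p K.toSubgroup) := by
  change Nat.card (pResidualCentralizer p (conjBy K.toSubgroup g)) = _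
  rw [conjBy_pResidualCentralizer, card_conjBy]

omit [Finite G] in
theorem card_centralizer_conj (K : NonidPSubgroup p G) (g : G) :
    Nat.card (Subgroup.centralizer ((K.conj g).toSubgroup : Set G)) =
      Nat.card (Subgroup.centralizer (K.toSubgroup : Set G)) := by
  change Nat.card (Subgroup.centralizer (conjBy K.toSubgroup g : Set G)) = _
  rw [conjBy_centralizer, card_conjBy]

end NonidPSubgroup

theorem isWeighting_linking : IsWeighting (LinkingCat p G) (fun H => (Nat.card G : ℚ)⁻¹ *
    ∑ K : NonidPSubgroup p G, subgroupMu H.as.sub.toSubgroup K.toSubgroup *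
      (Nat.card (pResidualCentralizer p K.toSubgroup) : ℚ)) :=
  isWeighting_of_card_mul_left (linkingRel p G)
    (fun K => Nat.card (pResidualCentralizer p K.toSubgroup)) (fun _ => Nat.card_pos.ne')
    NonidPSubgroup.card_pResidualCentralizer_conj card_hom_linking_mul

theorem isCoweighting_linking : IsCoweighting (LinkingCat p G) (fun K =>
    -(Nat.card G : ℚ)⁻¹ * subgroupMu ⊥ K.as.sub.toSubgroup *
      (Nat.card (pResidualCentralizer p K.as.sub.toSubgroup) : ℚ)) :=
  isCoweighting_of_card_mul_left (linkingRel p G)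
    (fun K => Nat.card (pResidualCentralizer p K.toSubgroup)) card_hom_linking_mul

theorem isWeighting_frobenius : IsWeighting (FrobeniusCat p G) (fun H => (Nat.card G : ℚ)⁻¹ *
    ∑ K : NonidPSubgroup p G, subgroupMu H.as.sub.toSubgroup K.toSubgroup *
      (Nat.card (Subgroup.centralizer (K.toSubgroup : Set G)) : ℚ)) :=
  isWeighting_of_card_mul_left (frobeniusRel p G)
    (fun K => Nat.card (Subgroup.centralizer (K.toSubgroup : Set G)))
    (fun _ => Nat.card_pos.ne') NonidPSubgroup.card_centralizer_conj card_hom_frobenius_mul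

theorem isCoweighting_frobenius : IsCoweighting (FrobeniusCat p G) (fun K =>
    -(Nat.card G : ℚ)⁻¹ * subgroupMu ⊥ K.as.sub.toSubgroup *
      (Nat.card (Subgroup.centralizer (K.as.sub.toSubgroup : Set G)) : ℚ)) :=
  isCoweighting_of_card_mul_left (frobeniusRel p G)
    (fun K => Nat.card (Subgroup.centralizer (K.toSubgroup : Set G))) card_hom_frobenius_mul

theorem isCoweighting_exterior : IsCoweighting (ExteriorCat p G) (fun K =>
    -(Nat.card G : ℚ)⁻¹ * subgroupMu ⊥ K.as.sub.toSubgroup *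
      (Nat.card (Subgroup.centralizer (K.as.sub.toSubgroup : Set G)) : ℚ)) :=
  IsCoweighting.exterior (p := p) (G := G) (k := fun K => -(Nat.card G : ℚ)⁻¹ * subgroupMu ⊥ K.toSubgroup *
    (Nat.card (Subgroup.centralizer (K.toSubgroup : Set G)) : ℚ)) isCoweighting_frobenius

variable (p G)

theorem hasEulerChar_poset : HasEulerChar (NonidPSubgroup p G) :=
  ⟨⟨_, isWeighting_poset⟩, ⟨_, isCoweighting_poset⟩⟩

theorem hasEulerChar_transporter : HasEulerChar (TransporterCat p G) :=
  ⟨⟨_, isWeighting_transporter⟩, ⟨_, isCoweighting_transporter⟩⟩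

theorem hasEulerChar_linking : HasEulerChar (LinkingCat p G) :=
  ⟨⟨_, isWeighting_linking⟩, ⟨_, isCoweighting_linking⟩⟩

theorem hasEulerChar_frobenius : HasEulerChar (FrobeniusCat p G) :=
  ⟨⟨_, isWeighting_frobenius⟩, ⟨_, isCoweighting_frobenius⟩⟩

theorem hasEulerChar_orbit : HasEulerChar (OrbitCat p G) :=
  ⟨⟨_, isWeighting_orbit⟩, ⟨_, isCoweighting_orbit⟩⟩

theorem hasEulerChar_exterior : HasEulerChar (ExteriorCat p G) :=
  ⟨exists_isWeighting_quotient _, ⟨_, isCoweighting_exterior⟩⟩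

theorem eulerChar_transporter : eulerChar (TransporterCat p G) =
    ∑ K : NonidPSubgroup p G, -(Nat.card G : ℚ)⁻¹ * subgroupMu ⊥ K.toSubgroup := by
  rw [(hasEulerChar_transporter p G).eulerChar_eq_sum_coweighting isCoweighting_transporter,
    sum_transporterCat]

theorem eulerChar_linking : eulerChar (LinkingCat p G) =
    ∑ K : NonidPSubgroup p G, -(Nat.card G : ℚ)⁻¹ * subgroupMu ⊥ K.toSubgroup *
      (Nat.card (pResidualCentralizer p K.toSubgroup) : ℚ) := by
  rw [(hasEulerChar_linking p G).eulerChar_eq_sum_coweighting isCoweighting_linking, sum_quotient]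

theorem eulerChar_frobenius : eulerChar (FrobeniusCat p G) =
    ∑ K : NonidPSubgroup p G, -(Nat.card G : ℚ)⁻¹ * subgroupMu ⊥ K.toSubgroup *
      (Nat.card (Subgroup.centralizer (K.toSubgroup : Set G)) : ℚ) := by
  rw [(hasEulerChar_frobenius p G).eulerChar_eq_sum_coweighting isCoweighting_frobenius,
    sum_quotient]

theorem eulerChar_poset : eulerChar (NonidPSubgroup p G) =
    (Nat.card G : ℚ) * eulerChar (TransporterCat p G) := by
  rw [(hasEulerChar_poset p G).eulerChar_eq_sum_coweighting isCoweighting_poset,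
    eulerChar_transporter, Finset.mul_sum]
  refine Finset.sum_congr rfl fun K _ => ?_
  rw [neg_mul, mul_neg, mul_inv_cancel_left₀ (card_ne_zero_rat G)]

/-- The two categories share a coweighting. -/
theorem eulerChar_exterior : eulerChar (ExteriorCat p G) = eulerChar (FrobeniusCat p G) := by
  rw [(hasEulerChar_exterior p G).eulerChar_eq_sum_coweighting isCoweighting_exterior,
    eulerChar_frobenius, sum_quotient]

theorem eulerChar_orbit : eulerChar (OrbitCat p G) = (Nat.card G : ℚ)⁻¹ *
    ∑ H : NonidPSubgroup p G, ∑ K : NonidPSubgroup p G,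
      (Nat.card H.toSubgroup : ℚ) * subgroupMu H.toSubgroup K.toSubgroup := by
  rw [(hasEulerChar_orbit p G).eulerChar_eq_sum_weighting isWeighting_orbit, sum_quotient,
    Finset.mul_sum]
  refine Finset.sum_congr rfl fun H _ => ?_
  rw [mul_assoc, ← Finset.mul_sum]

-- Summing the coweighting, rather than the weighting behind the double sum, separates the
-- transporter term from the cyclic one for each `K`.
variable {p} in
open scoped Classical in
theorem eulerChar_orbit_eq_sum_isCyclic (hp : p.Prime) :
    eulerChar (OrbitCat p G) = eulerChar (TransporterCat p G) +
      1 / (Nat.card G : ℚ) * (((p : ℚ) - 1) / p) *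
        ∑ C : NonidPSubgroup p G with IsCyclic C.toSubgroup, (Nat.card C.toSubgroup : ℚ) := by
  rw [(hasEulerChar_orbit p G).eulerChar_eq_sum_coweighting isCoweighting_orbit, sum_quotient,
    eulerChar_transporter, Finset.sum_filter, Finset.mul_sum, ← Finset.sum_add_distrib]
  refine Finset.sum_congr rfl fun K _ => ?_
  dsimp only
  rw [NonidPSubgroup.sum_card_mul_subgroupMu hp]
  split_ifs <;> ring

variable {p G} (rep : ConjClassesNonidP p G → NonidPSubgroup p G)

theorem eulerChar_transporter_eq_sum_conjClass
    (hrep : ∀ c : ConjClassesNonidP p G, (rep c).conjClass = c) :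
    eulerChar (TransporterCat p G) = ∑ c : ConjClassesNonidP p G,
      -subgroupMu ⊥ (rep c).toSubgroup / cardEnd (TransporterCat.mk (rep c)) := by
  have := NonidPSubgroup.sum_mul_subgroupMu_bot_eq_sum_conjClass rep hrep (fun _ => 1)
    (fun K => transporterCard K K) (fun _ _ => rfl) fun _ => mul_one _
  simp only [Nat.cast_one, mul_one] at this
  rw [eulerChar_transporter, this]
  rfl

theorem eulerChar_linking_eq_sum_conjClass
    (hrep : ∀ c : ConjClassesNonidP p G, (rep c).conjClass = c) :
    eulerChar (LinkingCat p G) = ∑ c : ConjClassesNonidP p G,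
      -subgroupMu ⊥ (rep c).toSubgroup / cardEnd ((rep c).toQuot (linkingRel p G)) := by
  rw [eulerChar_linking]
  exact NonidPSubgroup.sum_mul_subgroupMu_bot_eq_sum_conjClass rep hrep
    (fun K => Nat.card (pResidualCentralizer p K.toSubgroup))
    (fun K => Nat.card (K.toQuot (linkingRel p G) ⟶ K.toQuot (linkingRel p G)))
    NonidPSubgroup.card_pResidualCentralizer_conj fun K => card_hom_linking_mul K K

theorem eulerChar_frobenius_eq_sum_conjClass
    (hrep : ∀ c : ConjClassesNonidP p G, (rep c).conjClass = c) :
    eulerChar (FrobeniusCat p G) = ∑ c : ConjClassesNonidP p G,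
      -subgroupMu ⊥ (rep c).toSubgroup / cardEnd ((rep c).toQuot (frobeniusRel p G)) := by
  rw [eulerChar_frobenius]
  exact NonidPSubgroup.sum_mul_subgroupMu_bot_eq_sum_conjClass rep hrep
    (fun K => Nat.card (Subgroup.centralizer (K.toSubgroup : Set G)))
    (fun K => Nat.card (K.toQuot (frobeniusRel p G) ⟶ K.toQuot (frobeniusRel p G)))
    NonidPSubgroup.card_centralizer_conj fun K => card_hom_frobenius_mul K K

-- The class of `C` has `|G| / |N_G(C, C)|` members and `|N_G(C, C)| = |O(C)| |C|`, so the summand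
-- `|C|` cancels.
open scoped Classical in
theorem sum_card_isCyclic_eq_sum_conjClass
    (hrep : ∀ c : ConjClassesNonidP p G, (rep c).conjClass = c) :
    ∑ C : NonidPSubgroup p G with IsCyclic C.toSubgroup, (Nat.card C.toSubgroup : ℚ) =
      Nat.card G * ∑ c : ConjClassesNonidP p G with IsCyclic (rep c).toSubgroup,
        1 / cardEnd ((rep c).toQuot (orbitRel p G)) := by
  have hconj : ∀ (K : NonidPSubgroup p G) (g : G),
      (if IsCyclic (K.conj g).toSubgroup then (Nat.card (K.conj g).toSubgroup : ℚ) else 0) =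
        if IsCyclic K.toSubgroup then (Nat.card K.toSubgroup : ℚ) else 0 := fun K g => by
    have h1 : IsCyclic (K.conj g).toSubgroup ↔ IsCyclic K.toSubgroup := isCyclic_conjBy _ g
    have h2 : Nat.card (K.conj g).toSubgroup = Nat.card K.toSubgroup := card_conjBy _ g
    rw [h2, if_congr h1 rfl rfl]
  rw [Finset.sum_filter, NonidPSubgroup.sum_eq_sum_conjClass rep hrep _ hconj, Finset.sum_filter,
    Finset.mul_sum]
  refine Finset.sum_congr rfl fun c _ => ?_
  have h0 := NonidPSubgroup.transporterCard_self_ne_zero (rep c)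
  rw [← card_hom_orbit_mul, mul_ne_zero_iff] at h0
  have h1 : cardEnd ((rep c).toQuot (orbitRel p G)) ≠ 0 := Nat.cast_ne_zero.2 h0.1
  have h2 := card_ne_zero_rat (rep c).toSubgroup
  have h3 : (transporterCard (rep c) (rep c) : ℚ) =
      cardEnd ((rep c).toQuot (orbitRel p G)) * Nat.card (rep c).toSubgroup := by
    rw [← card_hom_orbit_mul, Nat.cast_mul, cardEnd]
  rw [h3]
  split_ifs
  · field_simp
  · simp

end EulerCharacteristics

open scoped Classical in
/-- `rep` is an arbitrary choice of representatives of the conjugacy classes of nonidentity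
`p`-subgroups; `subgroupMu ⊥ K` is `μ(K) = μ(1, K)`. -/
theorem theorem1p1 {G : Type*} [Group G] [Finite G] (p : ℕ) (hp : p.Prime)
    (rep : ConjClassesNonidP p G → NonidPSubgroup p G)
    (hrep : ∀ c : ConjClassesNonidP p G, (rep c).conjClass = c) :
    -- all six categories have Euler characteristic
    (HasEulerChar (NonidPSubgroup p G) ∧ HasEulerChar (TransporterCat p G) ∧
      HasEulerChar (LinkingCat p G) ∧ HasEulerChar (FrobeniusCat p G) ∧
      HasEulerChar (OrbitCat p G) ∧ HasEulerChar (ExteriorCat p G)) ∧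
    -- Euler characteristics of the transporter, linking and Frobenius categories
    eulerChar (TransporterCat p G) = ∑ c : ConjClassesNonidP p G,
      -subgroupMu ⊥ (rep c).toSubgroup / cardEnd (TransporterCat.mk (rep c)) ∧
    eulerChar (LinkingCat p G) = ∑ c : ConjClassesNonidP p G,
      -subgroupMu ⊥ (rep c).toSubgroup / cardEnd ((rep c).toQuot (linkingRel p G)) ∧
    eulerChar (FrobeniusCat p G) = ∑ c : ConjClassesNonidP p G,
      -subgroupMu ⊥ (rep c).toSubgroup / cardEnd ((rep c).toQuot (frobeniusRel p G)) ∧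
    -- the poset and the exterior quotient
    eulerChar (NonidPSubgroup p G) = (Nat.card G : ℚ) * eulerChar (TransporterCat p G) ∧
    eulerChar (ExteriorCat p G) = eulerChar (FrobeniusCat p G) ∧
    -- the orbit category
    eulerChar (OrbitCat p G) = eulerChar (TransporterCat p G) +
      ((p : ℚ) - 1) / p * ∑ c : ConjClassesNonidP p G with IsCyclic (rep c).toSubgroup,
        1 / cardEnd ((rep c).toQuot (orbitRel p G)) ∧
    eulerChar (OrbitCat p G) = eulerChar (TransporterCat p G) +
      1 / (Nat.card G : ℚ) * (((p : ℚ) - 1) / p) *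
        ∑ C : NonidPSubgroup p G with IsCyclic C.toSubgroup, (Nat.card C.toSubgroup : ℚ) ∧
    eulerChar (OrbitCat p G) = (Nat.card G : ℚ)⁻¹ *
      ∑ H : NonidPSubgroup p G, ∑ K : NonidPSubgroup p G,
        (Nat.card H.toSubgroup : ℚ) * subgroupMu H.toSubgroup K.toSubgroup ∧
    -- weighting and coweighting of the poset
    IsWeighting (NonidPSubgroup p G) (fun H =>
      ∑ K : NonidPSubgroup p G, subgroupMu H.toSubgroup K.toSubgroup) ∧
    IsCoweighting (NonidPSubgroup p G) (fun K => -subgroupMu ⊥ K.toSubgroup) ∧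
    -- weighting and coweighting of the transporter category
    IsWeighting (TransporterCat p G) (fun H => (Nat.card G : ℚ)⁻¹ *
      ∑ K : NonidPSubgroup p G, subgroupMu H.sub.toSubgroup K.toSubgroup) ∧
    IsCoweighting (TransporterCat p G) (fun K =>
      -(Nat.card G : ℚ)⁻¹ * subgroupMu ⊥ K.sub.toSubgroup) ∧
    -- weighting and coweighting of the linking category
    IsWeighting (LinkingCat p G) (fun H => (Nat.card G : ℚ)⁻¹ *
      ∑ K : NonidPSubgroup p G, subgroupMu H.as.sub.toSubgroup K.toSubgroup *
        (Nat.card (pResidualCentralizer p K.toSubgroup) : ℚ)) ∧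
    IsCoweighting (LinkingCat p G) (fun K =>
      -(Nat.card G : ℚ)⁻¹ * subgroupMu ⊥ K.as.sub.toSubgroup *
        (Nat.card (pResidualCentralizer p K.as.sub.toSubgroup) : ℚ)) ∧
    -- weighting and coweighting of the Frobenius category
    IsWeighting (FrobeniusCat p G) (fun H => (Nat.card G : ℚ)⁻¹ *
      ∑ K : NonidPSubgroup p G, subgroupMu H.as.sub.toSubgroup K.toSubgroup *
        (Nat.card (Subgroup.centralizer (K.toSubgroup : Set G)) : ℚ)) ∧
    IsCoweighting (FrobeniusCat p G) (fun K =>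
      -(Nat.card G : ℚ)⁻¹ * subgroupMu ⊥ K.as.sub.toSubgroup *
        (Nat.card (Subgroup.centralizer (K.as.sub.toSubgroup : Set G)) : ℚ)) ∧
    -- weighting and coweighting of the orbit category
    IsWeighting (OrbitCat p G) (fun H => (Nat.card G : ℚ)⁻¹ *
      (Nat.card H.as.sub.toSubgroup : ℚ) *
        ∑ K : NonidPSubgroup p G, subgroupMu H.as.sub.toSubgroup K.toSubgroup) ∧
    IsCoweighting (OrbitCat p G) (fun K => (Nat.card G : ℚ)⁻¹ *
      ∑ H : NonidPSubgroup p G, (Nat.card H.toSubgroup : ℚ) *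
        subgroupMu H.toSubgroup K.as.sub.toSubgroup) := by
  have hO := eulerChar_orbit_eq_sum_isCyclic G hp
  refine ⟨⟨hasEulerChar_poset p G, hasEulerChar_transporter p G, hasEulerChar_linking p G,
    hasEulerChar_frobenius p G, hasEulerChar_orbit p G, hasEulerChar_exterior p G⟩,
    eulerChar_transporter_eq_sum_conjClass rep hrep, eulerChar_linking_eq_sum_conjClass rep hrep,
    eulerChar_frobenius_eq_sum_conjClass rep hrep, eulerChar_poset p G, eulerChar_exterior p G,
    ?_, hO, eulerChar_orbit p G, isWeighting_poset, isCoweighting_poset, isWeighting_transporter,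
    isCoweighting_transporter, isWeighting_linking, isCoweighting_linking, isWeighting_frobenius,
    isCoweighting_frobenius, isWeighting_orbit, isCoweighting_orbit⟩
  rw [hO, sum_card_isCyclic_eq_sum_conjClass rep hrep, mul_comm (1 / (Nat.card G : ℚ)), mul_assoc,
    one_div, inv_mul_cancel_left₀ (card_ne_zero_rat G)]
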